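/- Let $\mathbb{Z}$ be a real Hilbert space, let $\mathcal{A}$ generate a $C^0$ semigroup $e^{\mathcal{A}t}$ on $\mathbb{Z}$, let $\mathcal{B}:\mathbb{R}^{n_u}\to\mathbb{Z}$ and $\mathcal{C}:\mathbb{Z}\to\mathbb{R}^{n_y}$ be bounded linear operators (so that $\mathcal{B}^\ast$ is bounded), and let $R\in\mathbb{R}^{n_u\times n_u}$ be symmetric positive definite. Let $\Pi$ be a bounded, self-adjoint, nonnegative solution of the algebraic Riccati equation $$\langle z_2,\Pi\mathcal{A}z_1\rangle+\langle\mathcal{A}z_2,\Pi z_1\rangle+\langle\mathcal{C}z_1,\mathcal{C}z_2\rangle-\langle\Pi\mathcal{B}R^{-1}\mathcal{B}^\ast\Pi z_1,z_2\rangle=0,\qquad z_1,z_2\in\mathcal{D}(\mathcal{A}),$$ and put $\mathcal{K}=R^{-1}\mathcal{B}^\ast\Pi$, $\mathcal{A}_m=\mathcal{A}-\mathcal{B}\mathcal{K}$. Assume that there are a bounded self-adjoint coercive operator $\mathcal{P}$ on $\mathbb{Z}$ and $\lambda_P>0$ with $\langle\mathcal{A}_mz,\mathcal{P}z\rangle+\langle\mathcal{P}z,\mathcal{A}_mz\rangle\le-\lambda_P\langle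 z,\mathcal{P}z\rangle$ for all $z\in\mathcal{D}(\mathcal{A}_m)=\mathcal{D}(\mathcal{A})$. Then $\mathcal{A}_m$ generates an exponentially stable $C^0$ semigroup $e^{\mathcal{A}_mt}$, and, with $e^{\mathcal{A}_m^\ast t}=(e^{\mathcal{A}_mt})^\ast$, the integrals $$W_oz=\int_0^\infty e^{\mathcal{A}_m^\ast\tau}\mathcal{C}^\ast\mathcal{C}e^{\mathcal{A}_m\tau}z\,d\tau,\qquad(\mathcal{A}_m^\ast)^{-1}\mathcal{C}^\ast r=-\int_0^\infty e^{\mathcal{A}_m^\ast\tau}\mathcal{C}^\ast r\,d\tau$$ exist for all $z\in\mathbb{Z}$ and $r\in\mathbb{R}^{n_y}$. Moreover there are constants $M,\beta>0$ such that for every constant reference $r\in\mathbb{R}^{n_y}$ and every mild solution $v_p$ of $\dot v_p=\mathcal{A}_mv_p$ (the particular half with $f\equiv0$) the following hold. 1. (Static feedforward.) For $T>0$ let $q_T(t)=\int_T^te^{-\mathcal{A}_m^\ast(t-s)}\mathcal{C}^\ast(r-\mathcal{C}v_p(s))\,ds$, $0\le t\le T$, be the mild solution of $\dot q=-\mathcal{A}_m^\ast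 q+\mathcal{C}^\ast(r-\mathcal{C}v_p)$, $q(T)=0$. For every $t\ge0$, as $T\to\infty$, $q_T(t)$ converges to $q(t)=W_ov_p(t)+(\mathcal{A}_m^\ast)^{-1}\mathcal{C}^\ast r$. 2. (Control laws.) The SDAC law $u_{\rm trk}=-\mathcal{K}v_h-R^{-1}\mathcal{B}^\ast q$, as a function of the state $v=v_p+v_h$, converges exponentially fast to the classic linear quadratic tracking law $u_{\rm lqt}(v)=-\mathcal{K}v-R^{-1}\mathcal{B}^\ast(\mathcal{A}_m^\ast)^{-1}\mathcal{C}^\ast r$, uniformly in the state: for all $t\ge0$ and $z\in\mathbb{Z}$, with $v_h=z-v_p(t)$, one has $\|u_{\rm trk}-u_{\rm lqt}(z)\|\le Me^{-\beta t}\|v_p(0)\|$. For each fixed $z$ this difference belongs to $\mathcal{L}_\infty(\mathbb{R}^+,\mathbb{R}^{n_u})$ as a function of $t$. 3. (Control signals.) Let $v^\star$ be any mild solution of $\dot v^\star=\mathcal{A}v^\star+\mathcal{B}u_{\rm lqt}(v^\star)$. Let either (a) $v_h$ be any mild solution of $\dot v_h=\mathcal{A}v_h+\mathcal{B}u_{\rm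 trk}$ and $v=v_p+v_h$, or (b) $v$ be any mild solution of $\dot v=\mathcal{A}v+\mathcal{B}u_{\rm trk}$, with $v_h=v-v_p$ in $u_{\rm trk}$. In both cases the difference $u_{\rm trk}(t)-u_{\rm lqt}(v^\star(t))$ of the control signals is bounded, i.e. belongs to $\mathcal{L}_\infty(\mathbb{R}^+,\mathbb{R}^{n_u})$, and $\|u_{\rm trk}(t)-u_{\rm lqt}(v^\star(t))\|\le Me^{-\beta t}\left(\|v_p(0)\|+\|v(0)-v^\star(0)\|\right)$ for all $t\ge0$. -/

import Mathlib

open Set Filter Topology MeasureTheory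

namespace SDAC

noncomputable section

/-- `S` (restricted to `t ≥ 0`) is a strongly continuous semigroup of bounded operators.
The values of `S` at negative times carry no information and are never used. -/
structure IsC0Semigroup {Z : Type*} [NormedAddCommGroup Z] [InnerProductSpace ℝ Z]
    (S : ℝ → Z →L[ℝ] Z) : Prop where
  zero : S 0 = ContinuousLinearMap.id ℝ Z
  add : ∀ s t : ℝ, 0 ≤ s → 0 ≤ t → S (s + t) = (S s).comp (S t)
  cont : ∀ z : Z, ContinuousOn (fun t : ℝ => S t z) (Ici 0)

/-- `A` is the infinitesimal generator of the strongly continuous semigroup `S`: the graph of `A`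
consists exactly of the pairs `(z, y)` with `y = lim_{h ↓ 0} (S h z - z) / h`. -/
def Generates {Z : Type*} [NormedAddCommGroup Z] [InnerProductSpace ℝ Z]
    (A : Z →ₗ.[ℝ] Z) (S : ℝ → Z →L[ℝ] Z) : Prop :=
  IsC0Semigroup S ∧
    ∀ z y : Z, (z, y) ∈ A.graph ↔
      Tendsto (fun h : ℝ => h⁻¹ • (S h z - z)) (𝓝[>] 0) (𝓝 y)

/-- `‖S t‖ ≤ M e^{-β t}` for all `t ≥ 0`, with some `M, β > 0`. -/
def IsExpStable {Z : Type*} [NormedAddCommGroup Z] [InnerProductSpace ℝ Z]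
    (S : ℝ → Z →L[ℝ] Z) : Prop :=
  ∃ M β : ℝ, 0 < M ∧ 0 < β ∧ ∀ t : ℝ, 0 ≤ t → ‖S t‖ ≤ M * Real.exp (-β * t)

/-- `v` is a mild solution on `[0, ∞)` of `v' = A v + f(t, v)`, `v(0) = v₀`, where `A` generates
`S`. -/
def IsMildSolution {Z : Type*} [NormedAddCommGroup Z] [InnerProductSpace ℝ Z]
    (S : ℝ → Z →L[ℝ] Z) (f : ℝ → Z → Z) (v₀ : Z) (v : ℝ → Z) : Prop :=
  ContinuousOn v (Ici 0) ∧
    ∀ t : ℝ, 0 ≤ t → v t = S t v₀ + ∫ s in (0 : ℝ)..t, S (t - s) (f s (v s))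

/-- The adjoint semigroup `t ↦ (S t)*`. -/
def adjSemigroup {Z : Type*} [NormedAddCommGroup Z] [InnerProductSpace ℝ Z] [CompleteSpace Z]
    (S : ℝ → Z →L[ℝ] Z) : ℝ → Z →L[ℝ] Z :=
  fun t => ContinuousLinearMap.adjoint (S t)

/-- The inverse of the generator of `S`, as `z ↦ - ∫₀^∞ S(τ) z dτ`. -/
def generatorInv {Z : Type*} [NormedAddCommGroup Z] [InnerProductSpace ℝ Z]
    (S : ℝ → Z →L[ℝ] Z) (z : Z) : Z :=
  -∫ τ in Ioi (0 : ℝ), S τ z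

section Control

variable {Z : Type*} [NormedAddCommGroup Z] [InnerProductSpace ℝ Z] [CompleteSpace Z] {nu ny : ℕ}

/-- `R⁻¹ B* : Z → ℝ^{nu}`. -/
def RinvBadj (B : EuclideanSpace ℝ (Fin nu) →L[ℝ] Z) (R : Matrix (Fin nu) (Fin nu) ℝ) :
    Z →L[ℝ] EuclideanSpace ℝ (Fin nu) :=
  (Matrix.toEuclideanCLM (n := Fin nu) (𝕜 := ℝ) R⁻¹).comp (ContinuousLinearMap.adjoint B)

/-- The feedback gain `K = R⁻¹ B* X`. -/
def gain (B : EuclideanSpace ℝ (Fin nu) →L[ℝ] Z) (R : Matrix (Fin nu) (Fin nu) ℝ)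
    (X : Z →L[ℝ] Z) : Z →L[ℝ] EuclideanSpace ℝ (Fin nu) :=
  (RinvBadj B R).comp X

/-- The closed-loop operator `A - B K`, with domain `D(A)`. -/
def closedLoop (A : Z →ₗ.[ℝ] Z) (B : EuclideanSpace ℝ (Fin nu) →L[ℝ] Z)
    (K : Z →L[ℝ] EuclideanSpace ℝ (Fin nu)) : Z →ₗ.[ℝ] Z where
  domain := A.domain
  toFun := A.toFun - (B.comp K).toLinearMap.comp A.domain.subtype

/-- `X` is a bounded, self-adjoint, nonnegative solution of the algebraic Riccati equation
`A* X + X A + C* C - X B R⁻¹ B* X = 0` (in weak form on `D(A)`). -/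
def SolvesRiccati (A : Z →ₗ.[ℝ] Z) (B : EuclideanSpace ℝ (Fin nu) →L[ℝ] Z)
    (C : Z →L[ℝ] EuclideanSpace ℝ (Fin ny)) (R : Matrix (Fin nu) (Fin nu) ℝ)
    (X : Z →L[ℝ] Z) : Prop :=
  X.IsPositive ∧
    ∀ z₁ z₂ : A.domain,
      inner ℝ (z₂ : Z) (X (A z₁)) + inner ℝ (A z₂) (X (z₁ : Z))
        + inner ℝ (C (z₁ : Z)) (C (z₂ : Z))
        - inner ℝ (X (B (RinvBadj B R (X (z₁ : Z))))) (z₂ : Z) = 0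

/-- There are a bounded self-adjoint coercive operator `P` and `lam > 0` with
`⟨A z, P z⟩ + ⟨P z, A z⟩ ≤ -lam ⟨z, P z⟩` on `D(A)`. -/
def HasCoerciveLyapunov (A : Z →ₗ.[ℝ] Z) : Prop :=
  ∃ (P : Z →L[ℝ] Z) (lam c : ℝ), IsSelfAdjoint P ∧ 0 < lam ∧ 0 < c ∧
    (∀ z : Z, c * ‖z‖ ^ 2 ≤ inner ℝ z (P z)) ∧
    ∀ z : A.domain,
      inner ℝ (A z) (P (z : Z)) + inner ℝ (P (z : Z)) (A z) ≤ -lam * inner ℝ (z : Z) (P (z : Z))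

/-- The mild solution `q(t) = ∫_T^t e^{-A_m*(t-s)} C* σ(s) ds` (used for `t ≤ T`) of
`q' = -A_m* q + C* σ`, `q(T) = 0`, where `A_m` generates `Sm`. -/
def costate (Sm : ℝ → Z →L[ℝ] Z) (C : Z →L[ℝ] EuclideanSpace ℝ (Fin ny))
    (σ : ℝ → EuclideanSpace ℝ (Fin ny)) (T t : ℝ) : Z :=
  ∫ s in T..t, adjSemigroup Sm (s - t) (ContinuousLinearMap.adjoint C (σ s))

/-- The integrand `e^{A_m* τ} C* C e^{A_m τ} z` of the observability Gramian. -/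
def gramianIntegrand (Sm : ℝ → Z →L[ℝ] Z) (C : Z →L[ℝ] EuclideanSpace ℝ (Fin ny)) (z : Z)
    (τ : ℝ) : Z :=
  adjSemigroup Sm τ (ContinuousLinearMap.adjoint C (C (Sm τ z)))

/-- The observability Gramian `W_o z = ∫₀^∞ e^{A_m* τ} C* C e^{A_m τ} z dτ`. -/
def gramian (Sm : ℝ → Z →L[ℝ] Z) (C : Z →L[ℝ] EuclideanSpace ℝ (Fin ny)) (z : Z) : Z :=
  ∫ τ in Ioi (0 : ℝ), gramianIntegrand Sm C z τ

/-- `(A_m*)⁻¹ C* r`. -/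
def refTerm (Sm : ℝ → Z →L[ℝ] Z) (C : Z →L[ℝ] EuclideanSpace ℝ (Fin ny))
    (r : EuclideanSpace ℝ (Fin ny)) : Z :=
  generatorInv (adjSemigroup Sm) (ContinuousLinearMap.adjoint C r)

/-- The static feedforward `q = W_o v_p + (A_m*)⁻¹ C* r`. -/
def staticFeedforward (Sm : ℝ → Z →L[ℝ] Z) (C : Z →L[ℝ] EuclideanSpace ℝ (Fin ny))
    (r : EuclideanSpace ℝ (Fin ny)) (vp : Z) : Z :=
  gramian Sm C vp + refTerm Sm C r

/-- The SDAC law `u = -K v_h - R⁻¹ B* q`, with `q` the static feedforward. -/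
def sdacLaw (Sm : ℝ → Z →L[ℝ] Z) (B : EuclideanSpace ℝ (Fin nu) →L[ℝ] Z)
    (C : Z →L[ℝ] EuclideanSpace ℝ (Fin ny)) (R : Matrix (Fin nu) (Fin nu) ℝ) (X : Z →L[ℝ] Z)
    (r : EuclideanSpace ℝ (Fin ny)) (vp vh : Z) : EuclideanSpace ℝ (Fin nu) :=
  -gain B R X vh - RinvBadj B R (staticFeedforward Sm C r vp)

/-- The classic linear quadratic tracking law `u = -K v - R⁻¹ B* (A_m*)⁻¹ C* r`. -/
def lqtLaw (Sm : ℝ → Z →L[ℝ] Z) (B : EuclideanSpace ℝ (Fin nu) →L[ℝ] Z)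
    (C : Z →L[ℝ] EuclideanSpace ℝ (Fin ny)) (R : Matrix (Fin nu) (Fin nu) ℝ) (X : Z →L[ℝ] Z)
    (r : EuclideanSpace ℝ (Fin ny)) (v : Z) : EuclideanSpace ℝ (Fin nu) :=
  -gain B R X v - RinvBadj B R (refTerm Sm C r)

end Control

end

end SDAC

namespace SDAC

/-! ### Strongly continuous operator families -/

section StronglyContinuous

variable {Z : Type*} [NormedAddCommGroup Z] [InnerProductSpace ℝ Z] [CompleteSpace Z]
  {S : ℝ → Z →L[ℝ] Z}

/-! The closed loop is a bounded perturbation of `A` by `D = -BK`. The Volterra equation `V = S + S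
* (D V)` is solved by a Neumann series after an exponential rescaling that makes the perturbation
small; uniqueness by Gronwall gives the semigroup law, and difference quotients identify the
generator as `A + D` (`Generates.closedLoop`). The functional `⟨z, P z⟩` decays along orbits
starting in the dense domain, which gives exponential stability (`Generates.isExpStable`). The
adjoint semigroup is again strongly continuous (`IsC0Semigroup.adjSemigroup`), so the integrals
defining `W_o` and the reference term converge absolutely.

For the control part, `v_p(s) = e^{A_m (s-t)} v_p(t)` turns the finite-horizon costate into a
truncated integral, whence the static feedforward (`tendsto_costate`). With `F = R⁻¹ B* W_o` the two
laws share the reference term, and at the same state they differ by `(K - F) v_p`, which decays.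
Along trajectories the error `e = v - v⋆` (or `v_h - v⋆`) solves `e' = A_m e + B G v_p` with `G`
equal to `K - F` (or `-F`). Variation of constants (`IsC0Semigroup.mild_perturbed`) bounds it by a
multiple of `(1 + t) e^{-βt}`, and halving the rate absorbs the factor `t`
(`exists_norm_control_difference_le`). -/

theorem exists_norm_le_of_continuousOn (hS : ∀ z, ContinuousOn (fun t => S t z) (Ici 0)) (T : ℝ) :
    ∃ M : ℝ, 0 < M ∧ ∀ t ∈ Icc 0 T, ‖S t‖ ≤ M := by
  obtain ⟨C, hC⟩ := banach_steinhaus (g := fun t : Icc (0 : ℝ) T => S t) fun z => by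
    obtain ⟨C, hC⟩ := isCompact_Icc.exists_bound_of_continuousOn
      ((hS z).mono (t := Icc 0 T) Icc_subset_Ici_self)
    exact ⟨C, fun t => hC t t.2⟩
  exact ⟨max C 1, by positivity, fun t ht => (hC ⟨t, ht⟩).trans (le_max_left _ _)⟩

/-- Joint continuity of `(t, z) ↦ S t z` for a strongly continuous family `S`. -/
theorem continuousOn_apply (hS : ∀ z, ContinuousOn (fun t => S t z) (Ici 0))
    {Y : Type*} [TopologicalSpace Y] {s : Set Y} {a : Y → ℝ} {f : Y → Z}
    (ha : ContinuousOn a s) (ha0 : ∀ y ∈ s, 0 ≤ a y) (hf : ContinuousOn f s) :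
    ContinuousOn (fun y => S (a y) (f y)) s := by
  intro x hx
  obtain ⟨M, hM0, hM⟩ := exists_norm_le_of_continuousOn hS (a x + 1)
  have h1 : Tendsto (fun y => S (a y) (f x)) (𝓝[s] x) (𝓝 (S (a x) (f x))) :=
    ((hS (f x)).comp ha ha0) x hx
  -- The moving vector is split off: the local operator bound controls `f y - f x`, strong
  -- continuity controls the fixed vector `f x`.
  have h2 : Tendsto (fun y => S (a y) (f y - f x)) (𝓝[s] x) (𝓝 0) := by
    have h3 : Tendsto (fun y => M * ‖f y - f x‖) (𝓝[s] x) (𝓝 0) := by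
      have : Tendsto (fun y => M * ‖f y - f x‖) (𝓝[s] x) (𝓝 (M * ‖f x - f x‖)) :=
        (((hf x hx).tendsto.sub_const _).norm).const_mul _
      simpa using this
    refine squeeze_zero_norm' ?_ h3
    have h4 : ∀ᶠ y in 𝓝[s] x, a y < a x + 1 :=
      (ha x hx).tendsto.eventually_lt_const (by linarith)
    filter_upwards [h4, self_mem_nhdsWithin] with y hy hys
    exact ((S (a y)).le_opNorm _).trans
      (mul_le_mul_of_nonneg_right (hM _ ⟨ha0 y hys, hy.le⟩) (norm_nonneg _))
  have h5 := h2.add h1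
  simp only [← map_add, sub_add_cancel, zero_add] at h5
  exact h5

theorem continuousOn_apply_sub (hS : ∀ z, ContinuousOn (fun t => S t z) (Ici 0))
    {f : ℝ → Z} (hf : ContinuousOn f (Ici 0)) (t : ℝ) :
    ContinuousOn (fun s => S (t - s) (f s)) (Icc 0 t) :=
  continuousOn_apply hS (by fun_prop) (fun _ hs => sub_nonneg.2 hs.2)
    (hf.mono Icc_subset_Ici_self)

theorem intervalIntegrable_apply_sub (hS : ∀ z, ContinuousOn (fun t => S t z) (Ici 0))
    {f : ℝ → Z} (hf : ContinuousOn f (Ici 0)) {a b t : ℝ} (ha : 0 ≤ a) (hab : a ≤ b)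
    (hb : b ≤ t) : IntervalIntegrable (fun s => S (t - s) (f s)) volume a b := by
  refine ContinuousOn.intervalIntegrable ((continuousOn_apply_sub hS hf t).mono ?_)
  rw [uIcc_of_le hab]
  exact Icc_subset_Icc ha hb

theorem continuousOn_convolution (hS : ∀ z, ContinuousOn (fun t => S t z) (Ici 0))
    {f : ℝ → Z} (hf : ContinuousOn f (Ici 0)) :
    ContinuousOn (fun t => ∫ s in (0 : ℝ)..t, S (t - s) (f s)) (Ici 0) := by
  -- Clamping both times at `0` makes the integrand continuous on the whole plane without changing
  -- it for `0 ≤ s ≤ t`.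
  have h : Continuous (fun p : ℝ × ℝ => S (max (p.1 - p.2) 0) (f (max p.2 0))) := by
    rw [← continuousOn_univ]
    refine continuousOn_apply hS (by fun_prop) (fun _ _ => le_max_right _ _) ?_
    exact hf.comp (by fun_prop) (fun _ _ => mem_Ici.2 (le_max_right _ _))
  have h2 := intervalIntegral.continuous_parametric_intervalIntegral_of_continuous (a₀ := (0 : ℝ))
    (f := fun t s => S (max (t - s) 0) (f (max s 0))) (μ := volume) h continuous_id
  refine h2.continuousOn.congr fun t (ht : 0 ≤ t) => ?_
  refine intervalIntegral.integral_congr fun s hs => ?_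
  rw [uIcc_of_le ht] at hs
  simp [max_eq_left hs.1, max_eq_left (sub_nonneg.2 hs.2)]

/-- If `g h s → c` as `0 ≤ s ≤ h ↓ 0`, then the means of `g h` over `[0, h]` tend to `c`. -/
theorem tendsto_mean_of_continuousOn {g : ℝ → ℝ → Z}
    (hg : ContinuousOn (fun p : ℝ × ℝ => g p.1 p.2) {p | 0 ≤ p.2 ∧ p.2 ≤ p.1}) :
    Tendsto (fun h : ℝ => h⁻¹ • ∫ s in (0 : ℝ)..h, g h s) (𝓝[>] 0) (𝓝 (g 0 0)) := by
  rw [Metric.tendsto_nhds]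
  intro ε hε
  have h0 := hg (0, 0) (by simp)
  obtain ⟨δ, hδ, hδ'⟩ := Metric.continuousWithinAt_iff.1 h0 (ε / 2) (by positivity)
  filter_upwards [Ioo_mem_nhdsGT hδ] with h hh
  have hint : IntervalIntegrable (fun s => g h s) volume 0 h := by
    refine ContinuousOn.intervalIntegrable ?_
    rw [uIcc_of_le hh.1.le]
    exact hg.comp (f := fun s : ℝ => (h, s)) (by fun_prop) fun s hs => ⟨hs.1, hs.2⟩
  have h1 : h⁻¹ • (∫ s in (0 : ℝ)..h, g h s) - g 0 0
      = h⁻¹ • ∫ s in (0 : ℝ)..h, (g h s - g 0 0) := by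
    rw [intervalIntegral.integral_sub hint (by simp), intervalIntegral.integral_const, sub_zero,
      smul_sub, smul_smul, inv_mul_cancel₀ hh.1.ne', one_smul]
  rw [dist_eq_norm, h1, norm_smul, norm_inv, Real.norm_of_nonneg hh.1.le]
  have h2 : ‖∫ s in (0 : ℝ)..h, (g h s - g 0 0)‖ ≤ ε / 2 * |h - 0| := by
    refine intervalIntegral.norm_integral_le_of_norm_le_const fun s hs => ?_
    rw [uIoc_of_le hh.1.le] at hs
    rw [← dist_eq_norm]
    refine (hδ' (x := (h, s)) ⟨hs.1.le, hs.2⟩ ?_).le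
    rw [Prod.dist_eq, max_lt_iff, Real.dist_0_eq_abs, Real.dist_0_eq_abs, abs_of_pos hh.1,
      abs_of_pos hs.1]
    exact ⟨hh.2, hs.2.trans_lt hh.2⟩
  rw [sub_zero, abs_of_pos hh.1] at h2
  calc h⁻¹ * ‖∫ s in (0 : ℝ)..h, (g h s - g 0 0)‖ ≤ h⁻¹ * (ε / 2 * h) :=
        mul_le_mul_of_nonneg_left h2 (inv_nonneg.2 hh.1.le)
    _ = ε / 2 := by field_simp [hh.1.ne']
    _ < ε := by linarith

theorem tendsto_mean_convolution (hS : ∀ z, ContinuousOn (fun t => S t z) (Ici 0))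
    (hS0 : S 0 = ContinuousLinearMap.id ℝ Z) {f : ℝ → Z} (hf : ContinuousOn f (Ici 0)) :
    Tendsto (fun h : ℝ => h⁻¹ • ∫ s in (0 : ℝ)..h, S (h - s) (f s)) (𝓝[>] 0) (𝓝 (f 0)) := by
  have h := tendsto_mean_of_continuousOn (g := fun h s => S (h - s) (f s))
    (continuousOn_apply hS (by fun_prop) (fun p hp => sub_nonneg.2 hp.2)
      (hf.comp (by fun_prop) fun p hp => hp.1))
  simpa [hS0] using h

theorem tendsto_mean_orbit (hS : ∀ z, ContinuousOn (fun t => S t z) (Ici 0))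
    (hS0 : S 0 = ContinuousLinearMap.id ℝ Z) (z : Z) :
    Tendsto (fun h : ℝ => h⁻¹ • ∫ s in (0 : ℝ)..h, S s z) (𝓝[>] 0) (𝓝 z) := by
  have h := tendsto_mean_of_continuousOn (g := fun _ s => S s z)
    ((hS z).comp (by fun_prop) fun p hp => hp.1)
  simpa [hS0] using h

end StronglyContinuous

/-! ### Growth, restarting and uniqueness for C⁰ semigroups -/

theorem IsC0Semigroup.add_apply {Z : Type*} [NormedAddCommGroup Z] [InnerProductSpace ℝ Z]
    {S : ℝ → Z →L[ℝ] Z} (hS : IsC0Semigroup S) {s t : ℝ} (hs : 0 ≤ s) (ht : 0 ≤ t)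
    (z : Z) : S (s + t) z = S s (S t z) := by
  rw [hS.add s t hs ht]; rfl

section Semigroup

variable {Z : Type*} [NormedAddCommGroup Z] [InnerProductSpace ℝ Z] [CompleteSpace Z]
  {S : ℝ → Z →L[ℝ] Z}

theorem IsC0Semigroup.exists_norm_le_exp (hS : IsC0Semigroup S) :
    ∃ M ω : ℝ, 0 < M ∧ 0 < ω ∧ ∀ t, 0 ≤ t → ‖S t‖ ≤ M * Real.exp (ω * t) := by
  obtain ⟨M', hM0', hM'⟩ := exists_norm_le_of_continuousOn hS.cont 1
  -- Each unit of time costs a factor `M`, so the growth rate is `log M`; the bound is enlarged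
  -- beyond `1` to make this rate positive.
  obtain ⟨M, hM1, hM⟩ : ∃ M : ℝ, 1 < M ∧ ∀ t ∈ Icc (0 : ℝ) 1, ‖S t‖ ≤ M :=
    ⟨M' + 1, by linarith, fun t ht => (hM' t ht).trans (by linarith)⟩
  have hM0 : 0 < M := by linarith
  have key : ∀ n : ℕ, ∀ t : ℝ, 0 ≤ t → t ≤ n + 1 → ‖S t‖ ≤ M ^ (n + 1) := by
    intro n
    induction n with
    | zero => intro t h0 h1; simpa using hM t ⟨h0, by simpa using h1⟩
    | succ n ih =>
      intro t h0 h1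
      push_cast at h1
      rcases le_total t 1 with h | h
      · exact (hM t ⟨h0, h⟩).trans (le_self_pow₀ hM1.le (by omega))
      · have h2 : S t = (S (t - 1)).comp (S 1) := by
          rw [← hS.add _ _ (by linarith) (by norm_num)]; simp
        rw [h2, pow_succ]
        refine (ContinuousLinearMap.opNorm_comp_le _ _).trans ?_
        exact mul_le_mul (ih _ (by linarith) (by linarith)) (hM 1 (by simp)) (norm_nonneg _)
          (by positivity)
  refine ⟨M, Real.log M, hM0, Real.log_pos hM1, fun t ht => ?_⟩
  refine (key ⌊t⌋₊ t ht (Nat.lt_floor_add_one t).le).trans ?_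
  rw [pow_succ, mul_comm, ← Real.rpow_natCast, Real.rpow_def_of_pos hM0]
  gcongr
  · exact Real.log_nonneg hM1.le
  · exact Nat.floor_le ht

/-- Restarting a mild solution at time `t`. -/
theorem IsC0Semigroup.mild_restart (hS : IsC0Semigroup S) {e k : ℝ → Z} {e₀ : Z}
    (hk : ContinuousOn k (Ici 0))
    (he : ∀ t, 0 ≤ t → e t = S t e₀ + ∫ s in (0 : ℝ)..t, S (t - s) (k s)) {t h : ℝ}
    (ht : 0 ≤ t) (hh : 0 ≤ h) :
    e (t + h) = S h (e t) + ∫ s in (0 : ℝ)..h, S (h - s) (k (t + s)) := by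
  have h1 : ∫ s in (0 : ℝ)..(t + h), S (t + h - s) (k s)
      = (∫ s in (0 : ℝ)..t, S (t + h - s) (k s)) + ∫ s in t..(t + h), S (t + h - s) (k s) :=
    (intervalIntegral.integral_add_adjacent_intervals
      (intervalIntegrable_apply_sub hS.cont hk le_rfl ht (by linarith))
      (intervalIntegrable_apply_sub hS.cont hk ht (by linarith) le_rfl)).symm
  have h2 : ∫ s in (0 : ℝ)..t, S (t + h - s) (k s) = S h (∫ s in (0 : ℝ)..t, S (t - s) (k s)) := by
    rw [← ContinuousLinearMap.intervalIntegral_comp_comm _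
      (intervalIntegrable_apply_sub hS.cont hk le_rfl ht le_rfl)]
    refine intervalIntegral.integral_congr fun s hs => ?_
    rw [uIcc_of_le ht] at hs
    rw [← hS.add_apply hh (sub_nonneg.2 hs.2)]
    congr 2
    ring
  have h3 : ∫ s in t..(t + h), S (t + h - s) (k s) = ∫ s in (0 : ℝ)..h, S (h - s) (k (t + s)) := by
    have := intervalIntegral.integral_comp_add_left (a := 0) (b := h)
      (fun s => S (t + h - s) (k s)) t
    rw [add_zero] at this
    rw [← this]
    refine intervalIntegral.integral_congr fun s _ => ?_
    congr 2
    ring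
  rw [he _ (add_nonneg ht hh), h1, h2, h3, he t ht, map_add, add_comm t h,
    hS.add_apply hh ht, add_assoc]

/-- Gronwall applied to the primitive of `‖u‖`, since `u` is only continuous: the primitive is
differentiable, vanishes at `0`, and its derivative is at most `M ‖D‖` times itself. -/
theorem eq_zero_of_eq_convolution (hS : ∀ z, ContinuousOn (fun t => S t z) (Ici 0))
    (D : Z →L[ℝ] Z) {u : ℝ → Z} (hu : ContinuousOn u (Ici 0))
    (hu' : ∀ t, 0 ≤ t → u t = ∫ s in (0 : ℝ)..t, S (t - s) (D (u s))) {t : ℝ} (ht : 0 ≤ t) :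
    u t = 0 := by
  obtain ⟨M, hM0, hM⟩ := exists_norm_le_of_continuousOn hS t
  have hw : Continuous (fun s => ‖u (max s 0)‖) :=
    (hu.comp_continuous (by fun_prop) fun s => mem_Ici.2 (le_max_right _ _)).norm
  have hV : ∀ x, HasDerivAt (fun x => ∫ s in (0 : ℝ)..x, ‖u (max s 0)‖) ‖u (max x 0)‖ x :=
    fun x => intervalIntegral.integral_hasDerivAt_right (hw.intervalIntegrable _ _)
      (hw.stronglyMeasurableAtFilter _ _) hw.continuousAt
  have hb : ∀ x ∈ Icc 0 t, ‖u x‖ ≤ M * ‖D‖ * ∫ s in (0 : ℝ)..x, ‖u (max s 0)‖ := by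
    intro x hx
    rw [hu' x hx.1, ← intervalIntegral.integral_const_mul]
    refine intervalIntegral.norm_integral_le_of_norm_le hx.1 ?_
      ((hw.const_mul _).intervalIntegrable _ _)
    refine ae_of_all _ fun s hs => ?_
    rw [max_eq_left hs.1.le, mul_assoc]
    refine ((S (x - s)).le_opNorm _).trans (mul_le_mul (hM _ ⟨?_, ?_⟩) (D.le_opNorm _)
      (norm_nonneg _) hM0.le)
    · linarith [hs.2]
    · linarith [hs.1, hx.2]
  have hz := eq_zero_of_abs_deriv_le_mul_abs_self_of_eq_zero_right
    (f := fun x => ∫ s in (0 : ℝ)..x, ‖u (max s 0)‖) (f' := fun x => ‖u (max x 0)‖)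
    (K := M * ‖D‖) (a := 0) (b := t)
    (fun x _ => (hV x).continuousAt.continuousWithinAt) (fun x _ => (hV x).hasDerivWithinAt)
    (by simp) (fun x hx => by
      rw [norm_norm, max_eq_left hx.1]
      refine (hb x ⟨hx.1, hx.2.le⟩).trans ?_
      exact mul_le_mul_of_nonneg_left (Real.le_norm_self _) (by positivity))
  have := hb t ⟨ht, le_rfl⟩
  rw [show (∫ s in (0 : ℝ)..t, ‖u (max s 0)‖) = 0 from hz t ⟨ht, le_rfl⟩, mul_zero] at this
  exact norm_le_zero_iff.1 this

end Semigroup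

end SDAC

namespace SDAC

/-! ### Bounded perturbation by a Neumann series -/

theorem integral_exp_neg_mul_sub_le {a : ℝ} (ha : 0 < a) (t : ℝ) :
    ∫ s in (0 : ℝ)..t, Real.exp (-a * (t - s)) ≤ 1 / a := by
  have h : ∀ s ∈ uIcc 0 t, HasDerivAt (fun s => Real.exp (-a * (t - s)) / a)
      (Real.exp (-a * (t - s))) s := fun s _ => by
    have h1 : HasDerivAt (fun s => -a * (t - s)) a s := by
      simpa using ((hasDerivAt_id s).const_sub t).const_mul (-a)
    simpa [ha.ne'] using h1.exp.div_const a
  rw [intervalIntegral.integral_eq_sub_of_hasDerivAt h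
    (Continuous.intervalIntegrable (by fun_prop) _ _)]
  have : 0 ≤ Real.exp (-a * (t - 0)) / a := by positivity
  simpa using this

section Perturbation

variable {Z : Type*} [NormedAddCommGroup Z] [InnerProductSpace ℝ Z] [CompleteSpace Z]

/-- On bounded continuous functions the Volterra operator `T w = U * (D w)` has norm at most `M ‖D‖
/ a ≤ 1/2`, so `1 - T` is invertible and the fixed point exists on the whole half-line at once. -/
theorem exists_eq_add_convolution_of_decay {U : ℝ → Z →L[ℝ] Z}
    (hU : ∀ z, ContinuousOn (fun t => U t z) (Ici 0)) (D : Z →L[ℝ] Z) {M a : ℝ} (hM : 0 < M)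
    (ha : 0 < a) (hUM : ∀ t, 0 ≤ t → ‖U t‖ ≤ M * Real.exp (-a * t)) (hD : M * ‖D‖ ≤ a / 2) :
    ∃ V : ℝ → Z →L[ℝ] Z, (∀ z, ContinuousOn (fun t => V t z) (Ici 0)) ∧
      ∀ t, 0 ≤ t → ∀ z, V t z = U t z + ∫ s in (0 : ℝ)..t, U (t - s) (D (V s z)) := by
  have hUM' : ∀ t, 0 ≤ t → ‖U t‖ ≤ M := fun t ht => (hUM t ht).trans <|
    mul_le_of_le_one_right hM.le (Real.exp_le_one_iff.2 (by nlinarith))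
  have hιb : ∀ z t, ‖U (max t 0) z‖ ≤ M * ‖z‖ := fun z t => ((U _).le_opNorm _).trans <|
    mul_le_mul_of_nonneg_right (hUM' _ (le_max_right _ _)) (norm_nonneg _)
  -- The map `ι` sends a vector to its `U`-orbit, extended to negative times by its value at `0`.
  let ι : Z →L[ℝ] BoundedContinuousFunction ℝ Z := LinearMap.mkContinuous
    { toFun := fun z => BoundedContinuousFunction.ofNormedAddCommGroup (fun t => U (max t 0) z)
        ((hU z).comp_continuous (by fun_prop) fun t => mem_Ici.2 (le_max_right _ _)) (M * ‖z‖)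
        (hιb z)
      map_add' := fun x y => by ext t; simp
      map_smul' := fun c x => by ext t; simp } M
    fun z => (BoundedContinuousFunction.norm_le (by positivity)).2 (hιb z)
  have hTc : ∀ w : BoundedContinuousFunction ℝ Z, Continuous
      (fun t => ∫ s in (0 : ℝ)..(max t 0), U (max t 0 - s) (D (w s))) := fun w =>
    (continuousOn_convolution hU (f := fun s => D (w s))
      (D.continuous.comp w.continuous).continuousOn).comp_continuous (f := fun t => max t 0)
      (by fun_prop) fun t => mem_Ici.2 (le_max_right _ _)
  have hTb : ∀ (w : BoundedContinuousFunction ℝ Z) t,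
      ‖∫ s in (0 : ℝ)..(max t 0), U (max t 0 - s) (D (w s))‖ ≤ 1 / 2 * ‖w‖ := by
    intro w t
    have ht : 0 ≤ max t 0 := le_max_right _ _
    generalize max t 0 = x at ht
    have h1 : ‖∫ s in (0 : ℝ)..x, U (x - s) (D (w s))‖
        ≤ ∫ s in (0 : ℝ)..x, M * ‖D‖ * ‖w‖ * Real.exp (-a * (x - s)) := by
      refine intervalIntegral.norm_integral_le_of_norm_le ht (ae_of_all _ fun s hs => ?_)
        (Continuous.intervalIntegrable (by fun_prop) _ _)
      calc ‖U (x - s) (D (w s))‖ ≤ ‖U (x - s)‖ * ‖D (w s)‖ := (U _).le_opNorm _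
        _ ≤ (M * Real.exp (-a * (x - s))) * (‖D‖ * ‖w‖) := by
          refine mul_le_mul (hUM _ (sub_nonneg.2 hs.2)) ?_ (norm_nonneg _) (by positivity)
          exact (D.le_opNorm _).trans
            (mul_le_mul_of_nonneg_left (w.norm_coe_le_norm s) (norm_nonneg _))
        _ = _ := by ring
    rw [intervalIntegral.integral_const_mul] at h1
    calc _ ≤ _ := h1
      _ ≤ (a / 2) * ‖w‖ * (1 / a) := by
        refine mul_le_mul (mul_le_mul_of_nonneg_right hD (norm_nonneg _))
          (integral_exp_neg_mul_sub_le ha x) ?_ (by positivity)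
        exact intervalIntegral.integral_nonneg ht fun s _ => (Real.exp_pos _).le
      _ = _ := by field_simp
  have hint : ∀ (w : BoundedContinuousFunction ℝ Z) t, IntervalIntegrable
      (fun s => U (max t 0 - s) (D (w s))) volume 0 (max t 0) := fun w t =>
    intervalIntegrable_apply_sub hU (f := fun s => D (w s))
      (D.continuous.comp w.continuous).continuousOn le_rfl (le_max_right _ _) le_rfl
  let T₀ : BoundedContinuousFunction ℝ Z →ₗ[ℝ] BoundedContinuousFunction ℝ Z :=
    { toFun := fun w => BoundedContinuousFunction.ofNormedAddCommGroup
        (fun t => ∫ s in (0 : ℝ)..(max t 0), U (max t 0 - s) (D (w s))) (hTc w) (1 / 2 * ‖w‖)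
        (hTb w)
      map_add' := fun x y => by
        ext t
        simp [intervalIntegral.integral_add (hint x t) (hint y t)]
      map_smul' := fun c x => by
        ext t
        simp }
  have hT₀ : ∀ w, ‖T₀ w‖ ≤ 1 / 2 * ‖w‖ := fun w =>
    (BoundedContinuousFunction.norm_le (by positivity)).2 (hTb w)
  let T := T₀.mkContinuous (1 / 2) hT₀
  have hT : ‖T‖ < 1 :=
    (T₀.mkContinuous_norm_le (by norm_num) hT₀).trans_lt (by norm_num)
  let J := ((Units.oneSub T hT)⁻¹).val
  have hJ : ∀ x, J x = x + T (J x) := fun x => by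
    have h : (1 - T) * J = 1 := (Units.oneSub T hT).mul_inv
    have h1 : (J x - T (J x)) = x := congrArg (fun L => L x) h
    rw [← sub_eq_iff_eq_add, h1]
  -- Composing evaluation, `J = (1 - T)⁻¹` and `ι` makes `V t` linear and bounded in `z` with no
  -- further argument.
  refine ⟨fun t => (BoundedContinuousFunction.evalCLM ℝ t).comp (J.comp ι), fun z =>
    (J (ι z)).continuous.continuousOn, fun t ht z => ?_⟩
  have h := congrArg (fun w : BoundedContinuousFunction ℝ Z => w t) (hJ (ι z))
  have h1 : (T (J (ι z))) t = ∫ s in (0 : ℝ)..(max t 0), U (max t 0 - s) (D (J (ι z) s)) := rfl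
  have h2 : ι z t = U (max t 0) z := rfl
  simp only [BoundedContinuousFunction.add_apply, h1, h2, max_eq_left ht] at h
  exact h

theorem IsC0Semigroup.exists_eq_add_convolution {S : ℝ → Z →L[ℝ] Z} (hS : IsC0Semigroup S)
    (D : Z →L[ℝ] Z) :
    ∃ V : ℝ → Z →L[ℝ] Z, (∀ z, ContinuousOn (fun t => V t z) (Ici 0)) ∧
      ∀ t, 0 ≤ t → ∀ z, V t z = S t z + ∫ s in (0 : ℝ)..t, S (t - s) (D (V s z)) := by
  obtain ⟨M, ω, hM, hω, hSM⟩ := hS.exists_norm_le_exp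
  -- Scaling by `e^{-(ω+a)t}` leaves decay rate `a`, and this `a` gives `M ‖D‖ ≤ a / 2`; the summand
  -- `1` keeps `a` positive when `D = 0`. The weight cancels in the convolution when the scaling is
  -- undone.
  set a := 2 * (M * (‖D‖ + 1)) with ha
  have ha0 : 0 < a := by positivity
  obtain ⟨V, hVc, hV⟩ := exists_eq_add_convolution_of_decay
    (U := fun t => Real.exp (-(ω + a) * t) • S t) (M := M) (a := a) (D := D)
    (fun z => ContinuousOn.smul (by fun_prop) (hS.cont z)) hM ha0 (fun t ht => by
      rw [norm_smul, Real.norm_of_nonneg (Real.exp_pos _).le]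
      calc _ ≤ Real.exp (-(ω + a) * t) * (M * Real.exp (ω * t)) :=
            mul_le_mul_of_nonneg_left (hSM t ht) (Real.exp_pos _).le
        _ = M * (Real.exp (-(ω + a) * t) * Real.exp (ω * t)) := by ring
        _ = _ := by rw [← Real.exp_add]; ring_nf) (by rw [ha]; nlinarith)
  refine ⟨fun t => Real.exp ((ω + a) * t) • V t,
    fun z => ContinuousOn.smul (by fun_prop) (hVc z), fun t ht z => ?_⟩
  have hexp : ∀ x : ℝ, Real.exp ((ω + a) * t) * Real.exp (-(ω + a) * (t - x))
      = Real.exp ((ω + a) * x) := fun x => by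
    rw [← Real.exp_add]; ring_nf
  have h0 := hexp 0
  rw [sub_zero, mul_zero, Real.exp_zero] at h0
  rw [smul_apply, hV t ht z, smul_add, smul_apply,
    smul_smul, h0, one_smul, ← intervalIntegral.integral_smul]
  congr 1
  refine intervalIntegral.integral_congr fun s _ => ?_
  simp only [smul_apply, map_smul, smul_smul, hexp]

end Perturbation

/-! ### The perturbed semigroup, its generator, variation of constants -/

section PerturbedSemigroup

variable {Z : Type*} [NormedAddCommGroup Z] [InnerProductSpace ℝ Z] [CompleteSpace Z]
  {S V : ℝ → Z →L[ℝ] Z} {D : Z →L[ℝ] Z}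

/-- For fixed `s`, both `t ↦ V (s + t) z` and `t ↦ V t (V s z)` solve the Volterra equation with
initial value `V s z`, so uniqueness gives the semigroup law. -/
theorem IsC0Semigroup.of_eq_add_convolution (hS : IsC0Semigroup S)
    (hVc : ∀ z, ContinuousOn (fun t => V t z) (Ici 0))
    (hV : ∀ t, 0 ≤ t → ∀ z, V t z = S t z + ∫ s in (0 : ℝ)..t, S (t - s) (D (V s z))) :
    IsC0Semigroup V := by
  have hDV : ∀ z, ContinuousOn (fun t => D (V t z)) (Ici 0) := fun z =>
    D.continuous.comp_continuousOn (hVc z)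
  have hshift : ∀ s, 0 ≤ s → ∀ z, ContinuousOn (fun t => V (s + t) z) (Ici 0) := fun s hs z =>
    (hVc z).comp (by fun_prop) fun t ht => add_nonneg hs ht
  refine ⟨by ext z; simpa [hS.zero] using hV 0 le_rfl z, fun t s ht hs => ?_, hVc⟩
  ext z
  have h := eq_zero_of_eq_convolution hS.cont D
    (u := fun t => V (s + t) z - V t (V s z)) ((hshift s hs z).sub (hVc _)) (fun t ht => by
      rw [hS.mild_restart (hDV z) (fun t ht => hV t ht z) hs ht, hV t ht (V s z),
        add_sub_add_left_eq_sub, ← intervalIntegral.integral_sub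
          (intervalIntegrable_apply_sub hS.cont (f := fun x => D (V (s + x) z))
            (D.continuous.comp_continuousOn (hshift s hs z)) le_rfl ht le_rfl)
          (intervalIntegrable_apply_sub hS.cont (hDV (V s z)) le_rfl ht le_rfl)]
      simp only [map_sub]) ht
  rw [add_comm t s]
  exact sub_eq_zero.1 h

/-- The two quotients differ by a mean of the convolution term, which tends to `D z`. The domain is
therefore unchanged and the generator gains `D`. -/
theorem tendsto_perturbed_quotient (hS : IsC0Semigroup S)
    (hVc : ∀ z, ContinuousOn (fun t => V t z) (Ici 0))
    (hV : ∀ t, 0 ≤ t → ∀ z, V t z = S t z + ∫ s in (0 : ℝ)..t, S (t - s) (D (V s z))) (z y : Z) :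
    Tendsto (fun h : ℝ => h⁻¹ • (V h z - z)) (𝓝[>] 0) (𝓝 y) ↔
      Tendsto (fun h : ℝ => h⁻¹ • (S h z - z)) (𝓝[>] 0) (𝓝 (y - D z)) := by
  have h0 := tendsto_mean_convolution hS.cont hS.zero (f := fun s => D (V s z)) (D.continuous.comp_continuousOn (hVc z))
  have hV0 : V 0 z = z := by simpa [hS.zero] using hV 0 le_rfl z
  rw [hV0] at h0
  have heq : ∀ᶠ h : ℝ in 𝓝[>] 0, h⁻¹ • (V h z - z)
      = h⁻¹ • (S h z - z) + h⁻¹ • ∫ s in (0 : ℝ)..h, S (h - s) (D (V s z)) := by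
    filter_upwards [self_mem_nhdsWithin] with h (hh : 0 < h)
    rw [hV h hh.le z, ← smul_add]
    congr 1
    abel
  constructor
  · intro h
    refine (h.sub h0).congr' ?_
    filter_upwards [heq] with t ht
    rw [ht, add_sub_cancel_right]
  · intro h
    have h1 := h.add h0
    rw [sub_add_cancel] at h1
    refine h1.congr' ?_
    filter_upwards [heq] with t ht
    rw [ht]

theorem Generates.closedLoop {nu : ℕ} {A : Z →ₗ.[ℝ] Z} (hA : Generates A S)
    {B : EuclideanSpace ℝ (Fin nu) →L[ℝ] Z} {K : Z →L[ℝ] EuclideanSpace ℝ (Fin nu)}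
    (hVc : ∀ z, ContinuousOn (fun t => V t z) (Ici 0))
    (hV : ∀ t, 0 ≤ t → ∀ z,
      V t z = S t z + ∫ s in (0 : ℝ)..t, S (t - s) ((-(B.comp K)) (V s z))) :
    Generates (closedLoop A B K) V := by
  refine ⟨hA.1.of_eq_add_convolution hVc hV, fun z y => ?_⟩
  rw [tendsto_perturbed_quotient hA.1 hVc hV, ← hA.2]
  simp only [LinearPMap.mem_graph_iff]
  constructor
  · rintro ⟨x, rfl, h⟩
    refine ⟨x, rfl, ?_⟩
    rw [← h]
    change A x = (A x - B (K x)) - -(B (K x))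
    abel
  · rintro ⟨x, rfl, h⟩
    refine ⟨x, rfl, ?_⟩
    change A x - B (K x) = y
    rw [h]
    change y - -(B (K x)) - B (K x) = y
    abel

/-- Variation of constants: a mild solution of `e' = (A + D) e + g`, formulated through `S`,
is given by the perturbed semigroup. -/
theorem IsC0Semigroup.mild_perturbed (hS : IsC0Semigroup S)
    (hVc : ∀ z, ContinuousOn (fun t => V t z) (Ici 0))
    (hV : ∀ t, 0 ≤ t → ∀ z, V t z = S t z + ∫ s in (0 : ℝ)..t, S (t - s) (D (V s z)))
    {e g : ℝ → Z} {e₀ : Z} (hec : ContinuousOn e (Ici 0)) (hg : ContinuousOn g (Ici 0))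
    (he : ∀ t, 0 ≤ t → e t = S t e₀ + ∫ s in (0 : ℝ)..t, S (t - s) (D (e s) + g s))
    {t : ℝ} (ht : 0 ≤ t) :
    e t = V t e₀ + ∫ s in (0 : ℝ)..t, V (t - s) (g s) := by
  have hVs := hS.of_eq_add_convolution hVc hV
  have hk : ContinuousOn (fun s => D (e s) + g s) (Ici 0) :=
    (D.continuous.comp_continuousOn hec).add hg
  -- The path `s ↦ V (t - s) (e s)` runs from `V t e₀` to `e t`. It has a right derivative although
  -- `e` may leave the domain, so the fundamental theorem for right derivatives applies.
  have hderiv : ∀ s ∈ Ioo 0 t, HasDerivWithinAt (fun s => V (t - s) (e s)) (V (t - s) (g s))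
      (Ioi s) s := by
    intro s hs
    have hshift : ∀ {f : ℝ → Z}, ContinuousOn f (Ici 0) →
        ContinuousOn (fun h => f (s + h)) (Ici 0) := fun hf =>
      hf.comp (by fun_prop) fun h hh => add_nonneg hs.1.le hh
    have h1 := tendsto_mean_convolution hS.cont hS.zero (hshift hk)
    have h2 := tendsto_mean_convolution hS.cont hS.zero (f := fun x => D (V x (e s)))
      (D.continuous.comp_continuousOn (hVc (e s)))
    -- Restarted at `s`, both orbits contain `S h (e s)`; it cancels, and the remaining means tend
    -- to `(D (e s) + g s) - D (e s)`.
    have h3 : Tendsto (fun h : ℝ => h⁻¹ • (e (s + h) - V h (e s))) (𝓝[>] 0) (𝓝 (g s)) := by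
      have h4 := h1.sub h2
      simp only [add_zero, hVs.zero, ContinuousLinearMap.id_apply, add_sub_cancel_left] at h4
      refine h4.congr' ?_
      filter_upwards [self_mem_nhdsWithin] with h (hh : 0 < h)
      rw [hS.mild_restart hk he hs.1.le hh.le, hV h hh.le (e s), add_sub_add_left_eq_sub, smul_sub]
    have h5 : Tendsto (fun h : ℝ => V (t - s - h) (h⁻¹ • (e (s + h) - V h (e s)))) (𝓝[>] 0)
        (𝓝 (V (t - s) (g s))) := by
      obtain ⟨M, hM0, hM⟩ := exists_norm_le_of_continuousOn hVc (t - s)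
      have hsmall : ∀ᶠ h : ℝ in 𝓝[>] 0, h ∈ Ioo 0 (t - s) :=
        Ioo_mem_nhdsGT (sub_pos.2 hs.2)
      have h6 : Tendsto (fun h : ℝ => V (t - s - h) (g s)) (𝓝[>] 0) (𝓝 (V (t - s) (g s))) := by
        have h7 : ContinuousWithinAt (fun h : ℝ => V (t - s - h) (g s)) (Icc 0 (t - s)) 0 :=
          ((hVc (g s)).comp (f := fun h : ℝ => t - s - h) (by fun_prop)
            fun h hh => mem_Ici.2 (by linarith [hh.2])) 0 ⟨le_rfl, sub_nonneg.2 hs.2.le⟩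
        have h8 := h7.tendsto
        rw [sub_zero] at h8
        refine h8.mono_left (le_inf nhdsWithin_le_nhds ?_)
        rw [le_principal_iff]
        filter_upwards [hsmall] with h hh using ⟨hh.1.le, hh.2.le⟩
      have h9 : Tendsto (fun h : ℝ => V (t - s - h) (h⁻¹ • (e (s + h) - V h (e s)) - g s))
          (𝓝[>] 0) (𝓝 0) := by
        have h10 : Tendsto (fun h : ℝ => M * ‖h⁻¹ • (e (s + h) - V h (e s)) - g s‖)
            (𝓝[>] 0) (𝓝 0) := by
          simpa using ((h3.sub_const (g s)).norm.const_mul M)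
        refine squeeze_zero_norm' ?_ h10
        filter_upwards [hsmall] with h hh
        exact ((V _).le_opNorm _).trans (mul_le_mul_of_nonneg_right
          (hM _ ⟨by linarith [hh.2], by linarith [hh.1]⟩) (norm_nonneg _))
      have h11 := h9.add h6
      simp only [← map_add, sub_add_cancel, zero_add] at h11
      exact h11
    rw [hasDerivWithinAt_iff_tendsto_slope' (by simp)]
    have h12 : Tendsto (fun x : ℝ => x - s) (𝓝[>] s) (𝓝[>] 0) := by
      refine tendsto_nhdsWithin_iff.2 ⟨?_, ?_⟩
      · have : Tendsto (fun x : ℝ => x - s) (𝓝 s) (𝓝 (s - s)) := (by fun_prop : Continuous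
          fun x : ℝ => x - s).tendsto s
        rw [sub_self] at this
        exact this.mono_left nhdsWithin_le_nhds
      · filter_upwards [self_mem_nhdsWithin] with x (hx : s < x) using sub_pos.2 hx
    refine (h5.comp h12).congr' ?_
    filter_upwards [Ioo_mem_nhdsGT hs.2] with x hx
    simp only [Function.comp_apply, slope, vsub_eq_sub]
    rw [map_smul, map_sub, ← hVs.add_apply (by linarith [hx.2]) (by linarith [hx.1])]
    congr 4 <;> ring_nf
  have hcont : ContinuousOn (fun s => V (t - s) (e s)) (Icc 0 t) :=
    continuousOn_apply_sub hVc hec t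
  have h := intervalIntegral.integral_eq_sub_of_hasDeriv_right_of_le ht hcont hderiv
    (intervalIntegrable_apply_sub hVc hg le_rfl ht le_rfl)
  have he0 : e 0 = e₀ := by simpa [hS.zero] using he 0 le_rfl
  rw [h, sub_self, sub_zero, hVs.zero, he0]
  simp

end PerturbedSemigroup

end SDAC

namespace SDAC

/-! ### Orbits in the domain and continuity from the origin -/

section NormedSpace

variable {Z : Type*} [NormedAddCommGroup Z] [InnerProductSpace ℝ Z] {S : ℝ → Z →L[ℝ] Z}

theorem IsC0Semigroup.intervalIntegrable (hS : IsC0Semigroup S) (z : Z) {a b : ℝ} (ha : 0 ≤ a)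
    (hb : 0 ≤ b) : IntervalIntegrable (fun s => S s z) volume a b :=
  ((hS.cont z).mono fun _ hs => (le_min ha hb).trans hs.1).intervalIntegrable

theorem Generates.tendsto_quotient_apply {A : Z →ₗ.[ℝ] Z} (hA : Generates A S) (z : A.domain)
    (t : ℝ) :
    Tendsto (fun h : ℝ => S t (h⁻¹ • (S h z - z))) (𝓝[>] 0) (𝓝 (S t (A z))) :=
  ((S t).continuous.tendsto _).comp ((hA.2 z (A z)).1 (A.mem_graph z))

theorem Generates.apply_mem_graph {A : Z →ₗ.[ℝ] Z} (hA : Generates A S) (z : A.domain) {t : ℝ}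
    (ht : 0 ≤ t) : (S t z, S t (A z)) ∈ A.graph := by
  refine (hA.2 _ _).2 ((hA.tendsto_quotient_apply z t).congr' ?_)
  filter_upwards [self_mem_nhdsWithin] with h (hh : 0 < h)
  rw [map_smul, map_sub, ← hA.1.add_apply ht hh.le, ← hA.1.add_apply hh.le ht, add_comm]

theorem Generates.hasDerivWithinAt {A : Z →ₗ.[ℝ] Z} (hA : Generates A S) (z : A.domain) {t : ℝ}
    (ht : 0 ≤ t) : HasDerivWithinAt (fun s => S s z) (S t (A z)) (Ici t) t := by
  rw [hasDerivWithinAt_iff_tendsto_slope, Ici_sdiff_left]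
  have h12 : Tendsto (fun x : ℝ => x - t) (𝓝[>] t) (𝓝[>] 0) := by
    refine tendsto_nhdsWithin_iff.2 ⟨?_, ?_⟩
    · have : Tendsto (fun x : ℝ => x - t) (𝓝 t) (𝓝 (t - t)) := (by fun_prop : Continuous
        fun x : ℝ => x - t).tendsto t
      rw [sub_self] at this
      exact this.mono_left nhdsWithin_le_nhds
    · filter_upwards [self_mem_nhdsWithin] with x (hx : t < x) using sub_pos.2 hx
  refine ((hA.tendsto_quotient_apply z t).comp h12).congr' ?_
  filter_upwards [self_mem_nhdsWithin] with x (hx : t < x)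
  simp only [Function.comp_apply, slope, vsub_eq_sub]
  rw [map_smul, map_sub, ← hA.1.add_apply ht (sub_nonneg.2 hx.le), add_sub_cancel]

theorem IsC0Semigroup.of_tendsto_zero {T : ℝ → Z →L[ℝ] Z}
    (h0 : T 0 = ContinuousLinearMap.id ℝ Z)
    (hadd : ∀ s t : ℝ, 0 ≤ s → 0 ≤ t → T (s + t) = (T s).comp (T t))
    (hb : ∀ t : ℝ, ∃ M : ℝ, 0 < M ∧ ∀ s ∈ Icc 0 t, ‖T s‖ ≤ M)
    (hlim : ∀ z, Tendsto (fun t => T t z) (𝓝[>] 0) (𝓝 z)) : IsC0Semigroup T := by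
  refine ⟨h0, hadd, fun z => Metric.continuousOn_iff.2 fun t (ht : 0 ≤ t) ε hε => ?_⟩
  obtain ⟨M, hM0, hM⟩ := hb (t + 1)
  obtain ⟨δ, hδ, hδ'⟩ := Metric.tendsto_nhdsWithin_nhds.1 (hlim z) (ε / M) (by positivity)
  -- Factoring out the operator at the earlier time, `T b z - T a z = T a (T (b - a) z - z)`, gives
  -- continuity from both sides out of the right limit at `0`.
  have key : ∀ a b : ℝ, 0 ≤ a → a ≤ b → a ≤ t + 1 → b - a < δ → dist (T b z) (T a z) < ε := by
    intro a b ha hab hat hd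
    rcases hab.eq_or_lt with rfl | hlt
    · simpa using hε
    have h1 := hδ' (x := b - a) (sub_pos.2 hlt)
      (by rw [Real.dist_0_eq_abs, abs_of_pos (sub_pos.2 hlt)]; exact hd)
    have h2 : T b z = T a (T (b - a) z) := by
      have := hadd a (b - a) ha (sub_nonneg.2 hab)
      rw [add_sub_cancel] at this
      rw [this]; rfl
    rw [dist_eq_norm] at h1
    rw [h2, dist_eq_norm, ← map_sub]
    calc _ ≤ ‖T a‖ * ‖T (b - a) z - z‖ := (T a).le_opNorm _
      _ ≤ M * ‖T (b - a) z - z‖ := mul_le_mul_of_nonneg_right (hM a ⟨ha, hat⟩) (norm_nonneg _)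
      _ < M * (ε / M) := mul_lt_mul_of_pos_left h1 hM0
      _ = ε := by field_simp
  refine ⟨min δ 1, by positivity, fun s (hs : 0 ≤ s) hst => ?_⟩
  rw [Real.dist_eq, lt_min_iff, abs_lt, abs_lt] at hst
  rcases le_total t s with h | h
  · exact key t s ht h (by linarith) hst.1.2
  · rw [dist_comm]
    exact key s t hs h (by linarith) (by linarith [hst.1.1])

end NormedSpace

/-! ### Density of the domain and Lyapunov stability -/

section Generator

variable {Z : Type*} [NormedAddCommGroup Z] [InnerProductSpace ℝ Z] [CompleteSpace Z]
  {S : ℝ → Z →L[ℝ] Z}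

theorem IsC0Semigroup.apply_integral (hS : IsC0Semigroup S) (z : Z) {t h : ℝ} (ht : 0 ≤ t)
    (hh : 0 ≤ h) : S t (∫ s in (0 : ℝ)..h, S s z) = ∫ s in (0 : ℝ)..h, S s (S t z) := by
  rw [← ContinuousLinearMap.intervalIntegral_comp_comm _ (hS.intervalIntegrable z le_rfl hh)]
  refine intervalIntegral.integral_congr fun s hs => ?_
  rw [uIcc_of_le hh] at hs
  rw [← hS.add_apply ht hs.1, ← hS.add_apply hs.1 ht, add_comm]

/-- Both sides are differences of the integral of the orbit over shifted intervals, and `t` and `h`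
play symmetric roles. Thus the increment of an averaged orbit over time `t` is an integral over `[0,
t]`, hence of order `t`. -/
theorem IsC0Semigroup.apply_integral_sub (hS : IsC0Semigroup S) (z : Z) {t h : ℝ} (ht : 0 ≤ t)
    (hh : 0 ≤ h) :
    S t (∫ s in (0 : ℝ)..h, S s z) - ∫ s in (0 : ℝ)..h, S s z
      = (∫ s in (0 : ℝ)..t, S s (S h z)) - ∫ s in (0 : ℝ)..t, S s z := by
  have hshift : ∀ a b : ℝ, 0 ≤ a → 0 ≤ b →
      ∫ s in (0 : ℝ)..b, S s (S a z) = ∫ s in a..(b + a), S s z := fun a b ha hb => by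
    have h1 := intervalIntegral.integral_comp_add_right (a := 0) (b := b) (fun s => S s z) a
    rw [zero_add] at h1
    rw [← h1]
    refine intervalIntegral.integral_congr fun s hs => ?_
    rw [uIcc_of_le hb] at hs
    exact (hS.add_apply hs.1 ha z).symm
  rw [hS.apply_integral z ht hh, hshift t h ht hh, hshift h t hh ht]
  have h3 := intervalIntegral.integral_add_adjacent_intervals
    (hS.intervalIntegrable z le_rfl ht) (hS.intervalIntegrable z ht (add_nonneg hh ht))
  have h4 := intervalIntegral.integral_add_adjacent_intervals
    (hS.intervalIntegrable z le_rfl hh) (hS.intervalIntegrable z hh (add_nonneg hh ht))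
  rw [add_comm t h, sub_eq_sub_iff_add_eq_add, add_comm, h3, ← h4]
  exact add_comm _ _

theorem IsC0Semigroup.integral_apply_sub (hS : IsC0Semigroup S) (z : Z) {t h : ℝ} (ht : 0 ≤ t)
    (hh : 0 ≤ h) :
    (∫ s in (0 : ℝ)..h, S s (S t z)) - ∫ s in (0 : ℝ)..h, S s z
      = (∫ s in (0 : ℝ)..t, S s (S h z)) - ∫ s in (0 : ℝ)..t, S s z := by
  rw [← hS.apply_integral_sub z ht hh, hS.apply_integral z ht hh]

/-- The averages of an orbit over `[0, h]` lie in the domain and tend to `z`. -/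
theorem Generates.dense_domain {A : Z →ₗ.[ℝ] Z} (hA : Generates A S) :
    Dense (A.domain : Set Z) := by
  intro z
  refine mem_closure_of_tendsto (tendsto_mean_orbit hA.1.cont hA.1.zero z) ?_
  filter_upwards [self_mem_nhdsWithin] with h (hh : 0 < h)
  refine A.domain.smul_mem _ ?_
  have h1 : Tendsto (fun t : ℝ => t⁻¹ • (S t (∫ s in (0 : ℝ)..h, S s z) - ∫ s in (0 : ℝ)..h, S s z))
      (𝓝[>] 0) (𝓝 (S h z - z)) := by
    refine ((tendsto_mean_orbit hA.1.cont hA.1.zero (S h z)).sub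
      (tendsto_mean_orbit hA.1.cont hA.1.zero z)).congr' ?_
    filter_upwards [self_mem_nhdsWithin] with t (ht : 0 < t)
    rw [hA.1.apply_integral_sub z ht.le hh.le, smul_sub]
  exact LinearPMap.mem_domain_of_mem_graph ((hA.2 _ _).2 h1)

/-- On the domain, `e^{lam s} ⟨S_s z, P S_s z⟩` has nonpositive right derivative. Coercivity turns
its monotonicity into a bound on `‖S_t z‖²`, which extends to all `z` by density; the square root
halves the rate. -/
theorem Generates.isExpStable {A : Z →ₗ.[ℝ] Z} (hA : Generates A S)
    (hL : HasCoerciveLyapunov A) : IsExpStable S := by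
  obtain ⟨P, lam, c, hP, hlam, hc, hcoer, hdiss⟩ := hL
  have hPsymm : ∀ x y : Z, inner ℝ (P x) y = inner ℝ x (P y) := fun x y => by
    rw [← ContinuousLinearMap.adjoint_inner_right, hP.adjoint_eq]
  have hdom : ∀ z ∈ A.domain, ∀ t, 0 ≤ t →
      c * ‖S t z‖ ^ 2 ≤ Real.exp (-lam * t) * (‖P‖ * ‖z‖ ^ 2) := by
    intro z hz t ht
    set V : ℝ → ℝ := fun s => inner ℝ (S s z) (P (S s z)) with hV
    have hVc : ContinuousOn V (Ici 0) :=
      (hA.1.cont z).inner (𝕜 := ℝ) (P.continuous.comp_continuousOn (hA.1.cont z))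
    have hVd : ∀ s, 0 ≤ s → ∃ d, HasDerivWithinAt V d (Ici s) s ∧ d ≤ -lam * V s := by
      intro s hs
      obtain ⟨w, hw1, hw2⟩ := (LinearPMap.mem_graph_iff _).1 (hA.apply_mem_graph ⟨z, hz⟩ hs)
      have hd := hA.hasDerivWithinAt ⟨z, hz⟩ hs
      have hd2 := P.hasFDerivAt.comp_hasDerivWithinAt s hd
      refine ⟨_, hd.inner ℝ hd2, ?_⟩
      have h1 := hdiss w
      simp only at hw1 hw2
      rw [hw1, hw2, hPsymm] at h1
      simp only [hV]
      linarith
    choose! d hd1 hd2 using hVd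
    have hexp : ∀ s, HasDerivAt (fun s => Real.exp (lam * s)) (Real.exp (lam * s) * lam) s :=
      fun s => by simpa using ((hasDerivAt_id s).const_mul lam).exp
    have hle := image_le_of_deriv_right_le_deriv_boundary
      (f := fun s => Real.exp (lam * s) * V s)
      (f' := fun s => Real.exp (lam * s) * lam * V s + Real.exp (lam * s) * d s)
      (a := 0) (b := t) (B := fun _ => V 0) (B' := fun _ => 0)
      (ContinuousOn.mul (by fun_prop) (hVc.mono Icc_subset_Ici_self))
      (fun s hs => (hexp s).hasDerivWithinAt.mul (hd1 s hs.1)) (by simp)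
      continuousOn_const (fun s _ => hasDerivWithinAt_const _ _ _)
      (fun s hs => by
        have := mul_le_mul_of_nonneg_left (hd2 s hs.1) (Real.exp_pos (lam * s)).le
        linarith) ⟨ht, le_rfl⟩
    have hV0 : V 0 ≤ ‖P‖ * ‖z‖ ^ 2 := by
      simp only [hV, hA.1.zero, ContinuousLinearMap.id_apply]
      calc inner ℝ z (P z) ≤ ‖z‖ * ‖P z‖ := real_inner_le_norm _ _
        _ ≤ ‖z‖ * (‖P‖ * ‖z‖) := mul_le_mul_of_nonneg_left (P.le_opNorm z) (norm_nonneg _)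
        _ = _ := by ring
    calc c * ‖S t z‖ ^ 2 ≤ V t := hcoer _
      _ = Real.exp (-lam * t) * (Real.exp (lam * t) * V t) := by
        rw [← mul_assoc, ← Real.exp_add]; simp
      _ ≤ _ := mul_le_mul_of_nonneg_left (hle.trans hV0) (Real.exp_pos _).le
  have hall : ∀ t, 0 ≤ t → ∀ z, c * ‖S t z‖ ^ 2 ≤ Real.exp (-lam * t) * (‖P‖ * ‖z‖ ^ 2) := by
    intro t ht z
    have hcl : IsClosed {z : Z | c * ‖S t z‖ ^ 2 ≤ Real.exp (-lam * t) * (‖P‖ * ‖z‖ ^ 2)} :=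
      isClosed_le (by fun_prop) (by fun_prop)
    exact hcl.closure_subset_iff.2 (fun z hz => hdom z hz t ht) (hA.dense_domain z)
  -- The summand `1` keeps the constant positive even when `P = 0`.
  refine ⟨√(‖P‖ / c) + 1, lam / 2, by positivity, by positivity, fun t ht => ?_⟩
  refine ContinuousLinearMap.opNorm_le_bound _ (by positivity) fun z => ?_
  have h1 : ‖S t z‖ ^ 2 ≤ (√(‖P‖ / c) * Real.exp (-(lam / 2) * t) * ‖z‖) ^ 2 := by
    have h2 : Real.exp (-(lam / 2) * t) ^ 2 = Real.exp (-lam * t) := by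
      rw [← Real.exp_nat_mul]; congr 1; push_cast; ring
    rw [mul_pow, mul_pow, Real.sq_sqrt (by positivity), h2]
    have h3 := hall t ht z
    calc ‖S t z‖ ^ 2 = (c * ‖S t z‖ ^ 2) / c := by field_simp
      _ ≤ (Real.exp (-lam * t) * (‖P‖ * ‖z‖ ^ 2)) / c := by gcongr
      _ = _ := by ring
  refine (le_of_sq_le_sq h1 (by positivity)).trans ?_
  gcongr
  linarith

end Generator

/-! ### Strong continuity of the adjoint semigroup -/

section Adjoint

variable {Z : Type*} [NormedAddCommGroup Z] [InnerProductSpace ℝ Z] [CompleteSpace Z]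
  {S : ℝ → Z →L[ℝ] Z}

theorem norm_adjSemigroup (S : ℝ → Z →L[ℝ] Z) (t : ℝ) : ‖adjSemigroup S t‖ = ‖S t‖ :=
  LinearIsometryEquiv.norm_map _ _

theorem IsC0Semigroup.exists_integral_clm (hS : IsC0Semigroup S) {h : ℝ} (hh : 0 ≤ h) :
    ∃ L : Z →L[ℝ] Z, ∀ z, L z = ∫ s in (0 : ℝ)..h, S s z := by
  obtain ⟨M, hM0, hM⟩ := exists_norm_le_of_continuousOn hS.cont h
  refine ⟨LinearMap.mkContinuous
    { toFun := fun z => ∫ s in (0 : ℝ)..h, S s z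
      map_add' := fun x y => by
        simp [intervalIntegral.integral_add (hS.intervalIntegrable x le_rfl hh)
          (hS.intervalIntegrable y le_rfl hh)]
      map_smul' := fun c x => by simp } (M * h) fun z => ?_, fun z => rfl⟩
  have := intervalIntegral.norm_integral_le_of_norm_le_const (a := 0) (b := h)
    (f := fun s => S s z) (C := M * ‖z‖) fun s hs => by
      rw [uIoc_of_le hh] at hs
      exact ((S s).le_opNorm z).trans
        (mul_le_mul_of_nonneg_right (hM s ⟨hs.1.le, hs.2⟩) (norm_nonneg _))
  rw [sub_zero, abs_of_nonneg hh] at this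
  exact this.trans_eq (by ring)

/-- The adjoint of a strongly continuous semigroup on a Hilbert space is strongly continuous. -/
theorem IsC0Semigroup.adjSemigroup (hS : IsC0Semigroup S) : IsC0Semigroup (adjSemigroup S) := by
  have hb : ∀ t : ℝ, ∃ M : ℝ, 0 < M ∧ ∀ s ∈ Icc 0 t, ‖SDAC.adjSemigroup S s‖ ≤ M := fun t => by
    simpa only [norm_adjSemigroup] using exists_norm_le_of_continuousOn hS.cont t
  have hadd : ∀ s t : ℝ, 0 ≤ s → 0 ≤ t →
      SDAC.adjSemigroup S (s + t) = (SDAC.adjSemigroup S s).comp (SDAC.adjSemigroup S t) :=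
    fun s t hs ht => by
      simp only [SDAC.adjSemigroup]
      rw [add_comm, hS.add t s ht hs, ContinuousLinearMap.adjoint_comp]
  have h0 : SDAC.adjSemigroup S 0 = ContinuousLinearMap.id ℝ Z := by
    simp only [SDAC.adjSemigroup, hS.zero]
    exact ContinuousLinearMap.adjoint_id
  -- The vectors at which the adjoint is right continuous at `0`. This subspace is shown to be
  -- dense; local boundedness then extends the continuity to all vectors.
  let E : Submodule ℝ Z :=
    { carrier := {y | Tendsto (fun t => SDAC.adjSemigroup S t y) (𝓝[>] 0) (𝓝 y)}
      add_mem' := fun {x y} hx hy => by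
        simpa using Tendsto.add (show Tendsto _ _ _ from hx) (show Tendsto _ _ _ from hy)
      zero_mem' := by simp
      smul_mem' := fun c x hx => by
        simpa using Tendsto.const_smul (show Tendsto _ _ _ from hx) c }
  -- With `L` the integral of `S` over `[0, h]`, the operator `L S_t - L` has norm of order `t`.
  -- Taking adjoints moves this norm estimate to `S_t* L* - L*`.
  have hE : ∀ h : ℝ, 0 < h → ∀ L : Z →L[ℝ] Z, (∀ z, L z = ∫ s in (0 : ℝ)..h, S s z) → ∀ y,
      ContinuousLinearMap.adjoint L y ∈ E := by
    intro h hh L hL y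
    obtain ⟨M, hM0, hM⟩ := exists_norm_le_of_continuousOn hS.cont 1
    have hbound : ∀ t ∈ Ioo (0 : ℝ) 1, ‖SDAC.adjSemigroup S t (ContinuousLinearMap.adjoint L y)
        - ContinuousLinearMap.adjoint L y‖ ≤ M * (‖S h‖ + 1) * t * ‖y‖ := by
      intro t ht
      have h1 : SDAC.adjSemigroup S t (ContinuousLinearMap.adjoint L y)
          - ContinuousLinearMap.adjoint L y
          = ContinuousLinearMap.adjoint (L.comp (S t) - L) y := by
        rw [map_sub, ContinuousLinearMap.adjoint_comp]; rfl
      have h2 : ‖L.comp (S t) - L‖ ≤ M * (‖S h‖ + 1) * t := by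
        refine ContinuousLinearMap.opNorm_le_bound _ (by have := ht.1; positivity) fun z => ?_
        have h3 : (L.comp (S t) - L) z
            = (∫ s in (0 : ℝ)..t, S s (S h z)) - ∫ s in (0 : ℝ)..t, S s z := by
          rw [← hS.integral_apply_sub z ht.1.le hh.le, ← hL, ← hL]; rfl
        have h4 : ∀ w : Z, ‖∫ s in (0 : ℝ)..t, S s w‖ ≤ M * ‖w‖ * t := fun w => by
          have := intervalIntegral.norm_integral_le_of_norm_le_const (a := 0) (b := t)
            (f := fun s => S s w) (C := M * ‖w‖) fun s hs => by
              rw [uIoc_of_le ht.1.le] at hs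
              exact ((S s).le_opNorm w).trans (mul_le_mul_of_nonneg_right
                (hM s ⟨hs.1.le, hs.2.trans ht.2.le⟩) (norm_nonneg _))
          rwa [sub_zero, abs_of_pos ht.1] at this
        rw [h3]
        calc _ ≤ M * ‖S h z‖ * t + M * ‖z‖ * t :=
              (norm_sub_le _ _).trans (add_le_add (h4 _) (h4 _))
          _ ≤ M * (‖S h‖ * ‖z‖) * t + M * ‖z‖ * t := by
            have := (S h).le_opNorm z
            have := ht.1
            gcongr
          _ = _ := by ring
      rw [h1]
      refine (ContinuousLinearMap.le_opNorm _ _).trans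
        (mul_le_mul_of_nonneg_right ?_ (norm_nonneg _))
      exact (LinearIsometryEquiv.norm_map ContinuousLinearMap.adjoint _).trans_le h2
    refine tendsto_iff_norm_sub_tendsto_zero.2 (squeeze_zero' (Eventually.of_forall fun _ =>
      norm_nonneg _) (g := fun t => M * (‖S h‖ + 1) * t * ‖y‖) ?_ ?_)
    · filter_upwards [Ioo_mem_nhdsGT one_pos] with t ht using hbound t ht
    · have : Continuous fun t : ℝ => M * (‖S h‖ + 1) * t * ‖y‖ := by fun_prop
      simpa using (this.tendsto 0).mono_left nhdsWithin_le_nhds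
  -- If `y ⟂ L* y` for every such `L`, then `⟨L y, y⟩ = 0`; dividing by `h` and letting `h ↓ 0`
  -- gives `⟨y, y⟩ = 0`.
  have hEperp : Eᗮ = ⊥ := by
    rw [Submodule.eq_bot_iff]
    intro y hy
    have h1 : Tendsto (fun h : ℝ => inner ℝ (h⁻¹ • ∫ s in (0 : ℝ)..h, S s y) y) (𝓝[>] 0)
        (𝓝 (inner ℝ y y)) :=
      (tendsto_mean_orbit hS.cont hS.zero y).inner tendsto_const_nhds
    have h2 : ∀ᶠ h : ℝ in 𝓝[>] 0, inner ℝ (h⁻¹ • ∫ s in (0 : ℝ)..h, S s y) y = 0 := by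
      filter_upwards [self_mem_nhdsWithin] with h (hh : 0 < h)
      obtain ⟨L, hL⟩ := hS.exists_integral_clm hh.le
      have h3 := (Submodule.mem_orthogonal' _ _).1 hy _ (hE h hh L hL y)
      rw [ContinuousLinearMap.adjoint_inner_right, hL] at h3
      rw [inner_smul_left, h3, mul_zero]
    exact inner_self_eq_zero.1 (tendsto_nhds_unique h1 (tendsto_const_nhds.congr'
      (h2.mono fun _ h => h.symm)))
  have hdense : Dense (E : Set Z) :=
    E.dense_iff_topologicalClosure_eq_top.2 (E.topologicalClosure_eq_top_iff.2 hEperp)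
  refine .of_tendsto_zero h0 hadd hb fun y => ?_
  obtain ⟨M, hM0, hM⟩ := hb 1
  rw [Metric.tendsto_nhds]
  intro ε hε
  obtain ⟨x, hx, hxy⟩ := Metric.dense_iff.1 hdense y (ε / (2 * (M + 1))) (by positivity)
  rw [Metric.mem_ball, dist_eq_norm] at hx
  have hx' : Tendsto (fun t => SDAC.adjSemigroup S t x) (𝓝[>] 0) (𝓝 x) := hxy
  filter_upwards [Metric.tendsto_nhds.1 hx' (ε / 2) (by positivity), Ioo_mem_nhdsGT one_pos]
    with t ht ht1
  rw [dist_eq_norm] at ht ⊢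
  have h1 : SDAC.adjSemigroup S t y - y = -(SDAC.adjSemigroup S t (x - y))
      + (SDAC.adjSemigroup S t x - x) + (x - y) := by
    rw [map_sub]; abel
  have h2 : ‖SDAC.adjSemigroup S t (x - y)‖ ≤ M * ‖x - y‖ :=
    (ContinuousLinearMap.le_opNorm _ _).trans
      (mul_le_mul_of_nonneg_right (hM t ⟨ht1.1.le, ht1.2.le⟩) (norm_nonneg _))
  rw [lt_div_iff₀ (by positivity)] at hx
  rw [h1]
  calc _ ≤ ‖SDAC.adjSemigroup S t (x - y)‖ + ‖SDAC.adjSemigroup S t x - x‖ + ‖x - y‖ := by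
        refine (norm_add_le _ _).trans ?_
        gcongr
        refine (norm_add_le _ _).trans ?_
        rw [norm_neg]
    _ < ε := by linarith

end Adjoint

end SDAC

namespace SDAC

/-! ### Estimates for exponentially decaying functions -/

theorem integrableOn_Ioi_of_exp_decay {E : Type*} [NormedAddCommGroup E]
    {f : ℝ → E} (hf : ContinuousOn f (Ici 0)) {c β : ℝ} (hβ : 0 < β)
    (hb : ∀ t, 0 ≤ t → ‖f t‖ ≤ c * Real.exp (-β * t)) : IntegrableOn f (Ioi 0) := by
  refine Integrable.mono' ((exp_neg_integrableOn_Ioi 0 hβ).const_mul c)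
    ((hf.mono Ioi_subset_Ici_self).aestronglyMeasurable measurableSet_Ioi) ?_
  filter_upwards [ae_restrict_mem measurableSet_Ioi] with t (ht : 0 < t) using hb t ht.le

theorem norm_integral_Ioi_le_of_exp_decay {E : Type*} [NormedAddCommGroup E] [NormedSpace ℝ E]
    {f : ℝ → E} {c β : ℝ} (hβ : 0 < β)
    (hb : ∀ t, 0 ≤ t → ‖f t‖ ≤ c * Real.exp (-β * t)) :
    ‖∫ t in Ioi (0 : ℝ), f t‖ ≤ c * ∫ t in Ioi (0 : ℝ), Real.exp (-β * t) := by
  rw [← integral_const_mul]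
  refine norm_integral_le_of_norm_le ((exp_neg_integrableOn_Ioi 0 hβ).const_mul c) ?_
  filter_upwards [ae_restrict_mem measurableSet_Ioi] with t (ht : 0 < t) using hb t ht.le

theorem memLp_top_of_exp_decay {E : Type*} [NormedAddCommGroup E]
    {f : ℝ → E} (hf : ContinuousOn f (Ici 0)) {c β : ℝ} (hβ : 0 < β) (hc : 0 ≤ c)
    (hb : ∀ t, 0 ≤ t → ‖f t‖ ≤ c * Real.exp (-β * t)) :
    MemLp f ⊤ (volume.restrict (Ici 0)) := by
  refine memLp_top_of_bound (hf.aestronglyMeasurable measurableSet_Ici) c ?_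
  filter_upwards [ae_restrict_mem measurableSet_Ici] with t (ht : 0 ≤ t)
  exact (hb t ht).trans (mul_le_of_le_one_right hc (Real.exp_le_one_iff.2 (by nlinarith)))

theorem exp_neg_mul_le_half {β t : ℝ} (hβ : 0 < β) (ht : 0 ≤ t) :
    Real.exp (-β * t) ≤ Real.exp (-(β / 2) * t) :=
  Real.exp_le_exp.2 (by nlinarith)

theorem mul_exp_neg_mul_le {β : ℝ} (hβ : 0 < β) (t : ℝ) :
    t * Real.exp (-β * t) ≤ 2 / β * Real.exp (-(β / 2) * t) := by
  have h1 : β / 2 * t ≤ Real.exp (β / 2 * t) := by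
    linarith [Real.add_one_le_exp (β / 2 * t)]
  have h2 : Real.exp (-(β / 2) * t) = Real.exp (β / 2 * t) * Real.exp (-β * t) := by
    rw [← Real.exp_add]; ring_nf
  rw [h2]
  calc t * Real.exp (-β * t) = 2 / β * (β / 2 * t * Real.exp (-β * t)) := by field_simp
    _ ≤ _ := by gcongr

/-- The forcing decays at the same rate as the semigroup: `e^{-β(t-s)} e^{-βs} = e^{-βt}` does not
depend on `s`, so the integral contributes `t e^{-βt}`. -/
theorem norm_mild_perturbed_le {Z : Type*} [NormedAddCommGroup Z]
    [InnerProductSpace ℝ Z] {Sm : ℝ → Z →L[ℝ] Z} {M β : ℝ} (hM : 0 < M)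
    (hb : ∀ t, 0 ≤ t → ‖Sm t‖ ≤ M * Real.exp (-β * t)) {e v : ℝ → Z} {e₀ v₀ : Z}
    (G : Z →L[ℝ] Z) (hv : ∀ t, 0 ≤ t → v t = Sm t v₀)
    (he : ∀ t, 0 ≤ t → e t = Sm t e₀ + ∫ s in (0 : ℝ)..t, Sm (t - s) (G (v s)))
    {t : ℝ} (ht : 0 ≤ t) :
    ‖e t‖ ≤ M * Real.exp (-β * t) * ‖e₀‖
      + M * ‖G‖ * M * ‖v₀‖ * (t * Real.exp (-β * t)) := by
  rw [he t ht]
  refine (norm_add_le _ _).trans (add_le_add (((Sm t).le_opNorm _).trans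
    (mul_le_mul_of_nonneg_right (hb t ht) (norm_nonneg _))) ?_)
  have h := intervalIntegral.norm_integral_le_of_norm_le_const (a := 0) (b := t)
    (f := fun s => Sm (t - s) (G (v s)))
    (C := M * ‖G‖ * M * ‖v₀‖ * Real.exp (-β * t)) fun s hs => by
      rw [uIoc_of_le ht] at hs
      have hexp : Real.exp (-β * t) = Real.exp (-β * (t - s)) * Real.exp (-β * s) := by
        rw [← Real.exp_add]; ring_nf
      calc ‖Sm (t - s) (G (v s))‖ ≤ ‖Sm (t - s)‖ * (‖G‖ * (‖Sm s‖ * ‖v₀‖)) := by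
            refine ((Sm _).le_opNorm _).trans ?_
            gcongr
            refine (G.le_opNorm _).trans ?_
            gcongr
            rw [hv s hs.1.le]
            exact (Sm s).le_opNorm _
        _ ≤ (M * Real.exp (-β * (t - s))) * (‖G‖ * ((M * Real.exp (-β * s)) * ‖v₀‖)) := by
            gcongr
            · exact hb _ (sub_nonneg.2 hs.2)
            · exact hb _ hs.1.le
        _ = _ := by rw [hexp]; ring
  rw [sub_zero, abs_of_nonneg ht] at h
  exact h.trans_eq (by ring)

/-! ### Gramian, costate limit and decay of control differences -/

section Control

variable {Z : Type*} [NormedAddCommGroup Z] [InnerProductSpace ℝ Z] [CompleteSpace Z] {nu ny : ℕ}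
  {S Sm : ℝ → Z →L[ℝ] Z} {M β : ℝ}

theorem continuousOn_gramianIntegrand (hSm : IsC0Semigroup Sm)
    (C : Z →L[ℝ] EuclideanSpace ℝ (Fin ny)) (z : Z) :
    ContinuousOn (gramianIntegrand Sm C z) (Ici 0) :=
  continuousOn_apply hSm.adjSemigroup.cont continuousOn_id (fun _ h => h)
    ((ContinuousLinearMap.continuous _).comp_continuousOn
      (C.continuous.comp_continuousOn (hSm.cont z)))

theorem norm_adjSemigroup_apply_le (hb : ∀ t, 0 ≤ t → ‖Sm t‖ ≤ M * Real.exp (-β * t)) (z : Z)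
    (t : ℝ) (ht : 0 ≤ t) : ‖adjSemigroup Sm t z‖ ≤ M * ‖z‖ * Real.exp (-β * t) := by
  refine ((adjSemigroup Sm t).le_opNorm z).trans ?_
  rw [norm_adjSemigroup, mul_right_comm]
  exact mul_le_mul_of_nonneg_right (hb t ht) (norm_nonneg _)

theorem norm_gramianIntegrand_le (hM : 0 < M) (hβ : 0 < β)
    (hb : ∀ t, 0 ≤ t → ‖Sm t‖ ≤ M * Real.exp (-β * t))
    (C : Z →L[ℝ] EuclideanSpace ℝ (Fin ny)) (z : Z) (t : ℝ) (ht : 0 ≤ t) :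
    ‖gramianIntegrand Sm C z t‖ ≤ M * (‖C‖ * (‖C‖ * M)) * ‖z‖ * Real.exp (-β * t) := by
  -- Only the decay of the adjoint factor is kept; rate `β` already suffices for integrability.
  have h1 : ‖Sm t z‖ ≤ M * ‖z‖ := ((Sm t).le_opNorm z).trans
    (mul_le_mul_of_nonneg_right ((hb t ht).trans (mul_le_of_le_one_right hM.le
      (Real.exp_le_one_iff.2 (by nlinarith)))) (norm_nonneg _))
  have h2 : ‖ContinuousLinearMap.adjoint C (C (Sm t z))‖ ≤ ‖C‖ * (‖C‖ * (M * ‖z‖)) := by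
    refine (ContinuousLinearMap.le_opNorm _ _).trans ?_
    rw [LinearIsometryEquiv.norm_map]
    gcongr
    exact (C.le_opNorm _).trans (by gcongr)
  refine (norm_adjSemigroup_apply_le hb _ t ht).trans ?_
  calc _ ≤ M * (‖C‖ * (‖C‖ * (M * ‖z‖))) * Real.exp (-β * t) := by gcongr
    _ = _ := by ring

theorem integrableOn_adjSemigroup (hSm : IsC0Semigroup Sm) (hβ : 0 < β)
    (hb : ∀ t, 0 ≤ t → ‖Sm t‖ ≤ M * Real.exp (-β * t)) (z : Z) :
    IntegrableOn (fun τ => adjSemigroup Sm τ z) (Ioi 0) :=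
  integrableOn_Ioi_of_exp_decay (hSm.adjSemigroup.cont z) hβ
    (norm_adjSemigroup_apply_le hb z)

theorem integrableOn_gramianIntegrand (hSm : IsC0Semigroup Sm) (hM : 0 < M) (hβ : 0 < β)
    (hb : ∀ t, 0 ≤ t → ‖Sm t‖ ≤ M * Real.exp (-β * t))
    (C : Z →L[ℝ] EuclideanSpace ℝ (Fin ny)) (z : Z) :
    IntegrableOn (gramianIntegrand Sm C z) (Ioi 0) :=
  integrableOn_Ioi_of_exp_decay (continuousOn_gramianIntegrand hSm C z) hβ
    (norm_gramianIntegrand_le hM hβ hb C z)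

/-- Makes `R⁻¹ B* W_o` a bounded operator, so the feedforward acts as a bounded feedback from `v_p`.
-/
theorem exists_gramian_clm (hSm : IsC0Semigroup Sm) (hM : 0 < M) (hβ : 0 < β)
    (hb : ∀ t, 0 ≤ t → ‖Sm t‖ ≤ M * Real.exp (-β * t))
    (C : Z →L[ℝ] EuclideanSpace ℝ (Fin ny)) :
    ∃ W : Z →L[ℝ] Z, ∀ z, gramian Sm C z = W z := by
  refine ⟨LinearMap.mkContinuous
    { toFun := gramian Sm C
      map_add' := fun x y => ?_
      map_smul' := fun c x => ?_ }
    (M * (‖C‖ * (‖C‖ * M)) * ∫ t in Ioi (0 : ℝ), Real.exp (-β * t)) fun z => ?_, fun z => rfl⟩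
  · simp only [gramian]
    rw [← integral_add (integrableOn_gramianIntegrand hSm hM hβ hb C x)
      (integrableOn_gramianIntegrand hSm hM hβ hb C y)]
    simp only [gramianIntegrand, map_add]
  · simp only [gramian, RingHom.id_apply]
    rw [← integral_smul]
    simp only [gramianIntegrand, map_smul]
  · refine (norm_integral_Ioi_le_of_exp_decay hβ
      (norm_gramianIntegrand_le hM hβ hb C z)).trans_eq ?_
    ring

/-- Since `v s = Sm (s - t) (v t)`, the substitution `τ = s - t` makes the costate minus the
integral over `[0, T - t]` of a fixed integrable function determined by `r` and `v t`. -/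
theorem tendsto_costate (hSm : IsC0Semigroup Sm) (hM : 0 < M) (hβ : 0 < β)
    (hb : ∀ t, 0 ≤ t → ‖Sm t‖ ≤ M * Real.exp (-β * t))
    (C : Z →L[ℝ] EuclideanSpace ℝ (Fin ny)) (r : EuclideanSpace ℝ (Fin ny)) {z : Z} {v : ℝ → Z}
    (hv : ∀ t, 0 ≤ t → v t = Sm t z) {t : ℝ} (ht : 0 ≤ t) :
    Tendsto (fun T : ℝ => costate Sm C (fun s => r - C (v s)) T t) atTop
      (𝓝 (staticFeedforward Sm C r (v t))) := by
  have h1 := integrableOn_adjSemigroup hSm hβ hb (ContinuousLinearMap.adjoint C r)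
  have h2 := integrableOn_gramianIntegrand hSm hM hβ hb C (v t)
  have hlim := (intervalIntegral_tendsto_integral_Ioi 0 (h1.sub h2)
    (tendsto_atTop_add_const_right atTop (-t) tendsto_id)).neg
  have hval : -∫ τ in Ioi (0 : ℝ), (adjSemigroup Sm τ (ContinuousLinearMap.adjoint C r)
      - gramianIntegrand Sm C (v t) τ) = staticFeedforward Sm C r (v t) := by
    rw [integral_sub h1 h2, staticFeedforward, refTerm, generatorInv, gramian]
    abel
  rw [← hval]
  refine hlim.congr' ?_
  filter_upwards [eventually_ge_atTop t] with T hT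
  have h3 := intervalIntegral.integral_comp_sub_right (a := T) (b := t)
    (fun τ => adjSemigroup Sm τ (ContinuousLinearMap.adjoint C r)
      - gramianIntegrand Sm C (v t) τ) t
  rw [← intervalIntegral.integral_symm, costate]
  rw [sub_self] at h3
  refine h3.symm.trans (intervalIntegral.integral_congr fun s hs => ?_)
  rw [uIcc_of_ge hT] at hs
  have h4 : v s = Sm (s - t) (v t) := by
    rw [hv t ht, ← hSm.add_apply (sub_nonneg.2 hs.1) ht, sub_add_cancel,
      hv s (ht.trans hs.1)]
  simp only [gramianIntegrand]
  rw [h4, map_sub, map_sub]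

/-- Exponential decay of the difference `-K e + G v` of two control signals, where
`e' = A e + B (-K e + G v)` and `v` is an orbit of the closed-loop semigroup. -/
theorem exists_norm_control_difference_le (hS : IsC0Semigroup S)
    {B : EuclideanSpace ℝ (Fin nu) →L[ℝ] Z} {K : Z →L[ℝ] EuclideanSpace ℝ (Fin nu)}
    (hVc : ∀ z, ContinuousOn (fun t => Sm t z) (Ici 0))
    (hV : ∀ t, 0 ≤ t → ∀ z,
      Sm t z = S t z + ∫ s in (0 : ℝ)..t, S (t - s) ((-(B.comp K)) (Sm s z)))
    (hM : 0 < M) (hβ : 0 < β) (hb : ∀ t, 0 ≤ t → ‖Sm t‖ ≤ M * Real.exp (-β * t))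
    (G : Z →L[ℝ] EuclideanSpace ℝ (Fin nu)) :
    ∃ N : ℝ, 0 < N ∧ ∀ (e v : ℝ → Z) (e₀ v₀ : Z), ContinuousOn e (Ici 0) →
      (∀ t, 0 ≤ t → v t = Sm t v₀) →
      (∀ t, 0 ≤ t → e t = S t e₀ + ∫ s in (0 : ℝ)..t, S (t - s) (B (-K (e s) + G (v s)))) →
      ∀ t, 0 ≤ t →
        ‖-K (e t) + G (v t)‖ ≤ N * Real.exp (-(β / 2) * t) * (‖v₀‖ + ‖e₀‖) := by
  set N₁ := M * ‖B.comp G‖ * M * (2 / β) with hN₁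
  have hN₁0 : 0 ≤ N₁ := by positivity
  refine ⟨‖K‖ * (M + N₁) + ‖G‖ * M + 1, by positivity, fun e v e₀ v₀ hec hv he t ht => ?_⟩
  have hvc : ContinuousOn v (Ici 0) := (hVc v₀).congr fun s hs => hv s hs
  -- The feedback `-B K e` is absorbed into the semigroup, leaving the forcing `B G v`.
  have he' := fun t ht => hS.mild_perturbed hVc hV (e := e) (g := fun s => (B.comp G) (v s))
    (e₀ := e₀) hec ((B.comp G).continuous.comp_continuousOn hvc) (fun t ht => by
      rw [he t ht]
      congr 1
      refine intervalIntegral.integral_congr fun s _ => ?_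
      simp) (t := t) ht
  have h1 := norm_mild_perturbed_le hM hb (B.comp G) hv he' ht
  have h2 := exp_neg_mul_le_half hβ ht
  have h3 := mul_exp_neg_mul_le hβ t
  set E := Real.exp (-(β / 2) * t) with hE
  have hE0 : 0 < E := Real.exp_pos _
  have h4 : ‖e t‖ ≤ (M + N₁) * E * (‖v₀‖ + ‖e₀‖) := by
    calc ‖e t‖ ≤ M * E * ‖e₀‖ + M * ‖B.comp G‖ * M * ‖v₀‖ * (2 / β * E) := by
          refine h1.trans ?_
          gcongr
      _ = M * E * ‖e₀‖ + N₁ * E * ‖v₀‖ := by rw [hN₁]; ring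
      _ ≤ M * E * (‖v₀‖ + ‖e₀‖) + N₁ * E * (‖v₀‖ + ‖e₀‖) := by
          gcongr
          · linarith [norm_nonneg v₀]
          · linarith [norm_nonneg e₀]
      _ = _ := by ring
  have h5 : ‖v t‖ ≤ M * E * (‖v₀‖ + ‖e₀‖) := by
    rw [hv t ht]
    refine ((Sm t).le_opNorm _).trans ?_
    have := (hb t ht).trans (mul_le_mul_of_nonneg_left h2 hM.le)
    gcongr
    linarith [norm_nonneg e₀]
  calc ‖-K (e t) + G (v t)‖ ≤ ‖K (e t)‖ + ‖G (v t)‖ := by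
        rw [← norm_neg (K (e t))]; exact norm_add_le _ _
    _ ≤ ‖K‖ * ‖e t‖ + ‖G‖ * ‖v t‖ := add_le_add (K.le_opNorm _) (G.le_opNorm _)
    _ ≤ ‖K‖ * ((M + N₁) * E * (‖v₀‖ + ‖e₀‖)) + ‖G‖ * (M * E * (‖v₀‖ + ‖e₀‖)) := by gcongr
    _ = (‖K‖ * (M + N₁) + ‖G‖ * M) * E * (‖v₀‖ + ‖e₀‖) := by ring
    _ ≤ _ := mul_le_mul_of_nonneg_right
        (mul_le_mul_of_nonneg_right (by linarith) hE0.le) (by positivity)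

/-- The difference of two mild solutions with the same linear part. -/
theorem IsMildSolution.sub_eq (hS : IsC0Semigroup S) {f g : ℝ → Z → Z} {v₀ w₀ : Z} {v w : ℝ → Z}
    (hv : IsMildSolution S f v₀ v) (hw : IsMildSolution S g w₀ w)
    (hf : ContinuousOn (fun s => f s (v s)) (Ici 0))
    (hg : ContinuousOn (fun s => g s (w s)) (Ici 0)) {t : ℝ} (ht : 0 ≤ t) :
    v t - w t = S t (v₀ - w₀) + ∫ s in (0 : ℝ)..t, S (t - s) (f s (v s) - g s (w s)) := by
  rw [hv.2 t ht, hw.2 t ht, add_sub_add_comm, ← map_sub, ← intervalIntegral.integral_sub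
    (intervalIntegrable_apply_sub hS.cont hf le_rfl ht le_rfl)
    (intervalIntegrable_apply_sub hS.cont hg le_rfl ht le_rfl)]
  simp only [map_sub]

end Control

end SDAC

/-! ### Assembly of the theorem -/

theorem lemma4 {Z : Type*} [NormedAddCommGroup Z] [InnerProductSpace ℝ Z] [CompleteSpace Z]
    {nu ny : ℕ}
    (A : Z →ₗ.[ℝ] Z) (S : ℝ → Z →L[ℝ] Z) (hA : SDAC.Generates A S)
    (B : EuclideanSpace ℝ (Fin nu) →L[ℝ] Z) (C : Z →L[ℝ] EuclideanSpace ℝ (Fin ny))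
    (R : Matrix (Fin nu) (Fin nu) ℝ) (hR : R.PosDef)
    (X : Z →L[ℝ] Z) (hX : SDAC.SolvesRiccati A B C R X)
    (hLyap : SDAC.HasCoerciveLyapunov (SDAC.closedLoop A B (SDAC.gain B R X))) :
    ∃ Sm : ℝ → Z →L[ℝ] Z,
      -- `A_m = A - B K` generates an exponentially stable semigroup `Sm`
      SDAC.Generates (SDAC.closedLoop A B (SDAC.gain B R X)) Sm ∧
      SDAC.IsExpStable Sm ∧
      -- the integrals that define `W_o` and `(A_m*)⁻¹ C* r` exist
      (∀ z : Z, IntegrableOn (SDAC.gramianIntegrand Sm C z) (Ioi 0)) ∧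
      (∀ r : EuclideanSpace ℝ (Fin ny), IntegrableOn
        (fun τ : ℝ => SDAC.adjSemigroup Sm τ (ContinuousLinearMap.adjoint C r)) (Ioi 0)) ∧
      ∃ M β : ℝ, 0 < M ∧ 0 < β ∧
        ∀ (r : EuclideanSpace ℝ (Fin ny)) (vp₀ : Z) (vp : ℝ → Z),
          -- the particular half `v_p' = A_m v_p`
          SDAC.IsMildSolution Sm (fun _ _ => 0) vp₀ vp →
          -- the static feedforward is the infinite-horizon limit of the costate
          (∀ t : ℝ, 0 ≤ t →
            Tendsto (fun T : ℝ => SDAC.costate Sm C (fun s => r - C (vp s)) T t) atTop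
              (𝓝 (SDAC.staticFeedforward Sm C r (vp t)))) ∧
          -- as maps of the state `z = v_p + v_h`, the laws converge exponentially fast
          (∀ t : ℝ, 0 ≤ t → ∀ z : Z,
            ‖SDAC.sdacLaw Sm B C R X r (vp t) (z - vp t) - SDAC.lqtLaw Sm B C R X r z‖
              ≤ M * Real.exp (-β * t) * ‖vp₀‖) ∧
          (∀ z : Z, MemLp
            (fun t : ℝ =>
              SDAC.sdacLaw Sm B C R X r (vp t) (z - vp t) - SDAC.lqtLaw Sm B C R X r z)
            ⊤ (volume.restrict (Ici 0))) ∧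
          -- the control signals, compared along the LQT trajectory `v⋆' = A v⋆ + B u_lqt(v⋆)`
          (∀ (vs₀ : Z) (vs : ℝ → Z),
            SDAC.IsMildSolution S (fun _ z => B (SDAC.lqtLaw Sm B C R X r z)) vs₀ vs →
            -- with the homogeneous half `v_h' = A v_h + B u`, `u` the SDAC law
            (∀ (vh₀ : Z) (vh : ℝ → Z),
              SDAC.IsMildSolution S (fun s z => B (SDAC.sdacLaw Sm B C R X r (vp s) z)) vh₀ vh →
              (∀ t : ℝ, 0 ≤ t →
                ‖SDAC.sdacLaw Sm B C R X r (vp t) (vh t) - SDAC.lqtLaw Sm B C R X r (vs t)‖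
                  ≤ M * Real.exp (-β * t) * (‖vp₀‖ + ‖vp₀ + vh₀ - vs₀‖)) ∧
              MemLp
                (fun t : ℝ =>
                  SDAC.sdacLaw Sm B C R X r (vp t) (vh t) - SDAC.lqtLaw Sm B C R X r (vs t))
                ⊤ (volume.restrict (Ici 0))) ∧
            -- with the plant `v' = A v + B u`, `u` the SDAC law with `v_h = v - v_p`
            (∀ (v₀ : Z) (v : ℝ → Z),
              SDAC.IsMildSolution S
                (fun s z => B (SDAC.sdacLaw Sm B C R X r (vp s) (z - vp s))) v₀ v →
              (∀ t : ℝ, 0 ≤ t →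
                ‖SDAC.sdacLaw Sm B C R X r (vp t) (v t - vp t) - SDAC.lqtLaw Sm B C R X r (vs t)‖
                  ≤ M * Real.exp (-β * t) * (‖vp₀‖ + ‖v₀ - vs₀‖)) ∧
              MemLp
                (fun t : ℝ =>
                  SDAC.sdacLaw Sm B C R X r (vp t) (v t - vp t) - SDAC.lqtLaw Sm B C R X r (vs t))
                ⊤ (volume.restrict (Ici 0)))) := by
  set K := SDAC.gain B R X with hK
  obtain ⟨Sm, hVc, hV⟩ := hA.1.exists_eq_add_convolution (-(B.comp K))
  have hgen : SDAC.Generates (SDAC.closedLoop A B K) Sm := hA.closedLoop hVc hV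
  have hSm := hgen.1
  have hstab := hgen.isExpStable hLyap
  refine ⟨Sm, hgen, hstab, ?_⟩
  obtain ⟨M, β, hM, hβ, hb⟩ := hstab
  refine ⟨SDAC.integrableOn_gramianIntegrand hSm hM hβ hb C, fun r =>
    SDAC.integrableOn_adjSemigroup hSm hβ hb _, ?_⟩
  obtain ⟨W, hW⟩ := SDAC.exists_gramian_clm hSm hM hβ hb C
  set F := (SDAC.RinvBadj B R).comp W with hF
  -- At a common state the homogeneous half is `z - v_p`, so `K v_p` returns with a plus sign and
  -- the laws differ by `K v_p - F v_p`.
  set L := K - F with hL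
  -- In case (a) the feedback sees `v_h` directly and the forcing is `-F v_p`; in case (b) it sees
  -- `v - v_p` and the forcing is `L v_p`.
  obtain ⟨N₁, hN₁, hdiff₁⟩ :=
    SDAC.exists_norm_control_difference_le hA.1 hVc hV hM hβ hb (-F)
  obtain ⟨N₂, hN₂, hdiff₂⟩ :=
    SDAC.exists_norm_control_difference_le hA.1 hVc hV hM hβ hb L
  have hsdac : ∀ r x y, SDAC.sdacLaw Sm B C R X r x y
      = -K y - F x - SDAC.RinvBadj B R (SDAC.refTerm Sm C r) := fun r x y => by
    simp only [SDAC.sdacLaw, SDAC.staticFeedforward, hW, map_add, hF,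
      ContinuousLinearMap.comp_apply, ← hK]
    abel
  have hlqt : ∀ r x, SDAC.lqtLaw Sm B C R X r x
      = -K x - SDAC.RinvBadj B R (SDAC.refTerm Sm C r) := fun r x => rfl
  -- One constant for all three bounds: `2 * N₁` for case (a), `N₂` for case (b), `‖L‖ * M` for the
  -- laws.
  refine ⟨2 * N₁ + N₂ + ‖L‖ * M, β / 2, by positivity, by positivity, fun r vp₀ vp hvp => ?_⟩
  have hβ2 : 0 < β / 2 := by positivity
  have hvp' : ∀ t, 0 ≤ t → vp t = Sm t vp₀ := fun t ht => by simpa using hvp.2 t ht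
  have hlaw : ∀ t z, SDAC.sdacLaw Sm B C R X r (vp t) (z - vp t) - SDAC.lqtLaw Sm B C R X r z
      = L (vp t) := fun t z => by
    simp only [hsdac, hlqt, hL, map_sub, sub_apply]
    abel
  have hlawb : ∀ t, 0 ≤ t →
      ‖L (vp t)‖ ≤ (2 * N₁ + N₂ + ‖L‖ * M) * Real.exp (-(β / 2) * t) * ‖vp₀‖ := fun t ht => by
    rw [hvp' t ht]
    calc ‖L (Sm t vp₀)‖ ≤ ‖L‖ * (‖Sm t‖ * ‖vp₀‖) := (L.le_opNorm _).trans
          (mul_le_mul_of_nonneg_left ((Sm t).le_opNorm _) (norm_nonneg _))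
      _ ≤ ‖L‖ * ((M * Real.exp (-(β / 2) * t)) * ‖vp₀‖) := by
        have := (hb t ht).trans
          (mul_le_mul_of_nonneg_left (SDAC.exp_neg_mul_le_half hβ ht) hM.le)
        gcongr
      _ = (‖L‖ * M) * Real.exp (-(β / 2) * t) * ‖vp₀‖ := by ring
      _ ≤ _ := by
        gcongr
        linarith
  refine ⟨fun t ht => SDAC.tendsto_costate hSm hM hβ hb C r hvp' ht,
    fun t ht z => by rw [hlaw]; exact hlawb t ht, fun z => ?_, fun vs₀ vs hvs => ?_⟩
  · simp only [hlaw]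
    refine SDAC.memLp_top_of_exp_decay
      (L.continuous.comp_continuousOn hvp.1) hβ2 (c := (2 * N₁ + N₂ + ‖L‖ * M) * ‖vp₀‖)
      (by positivity) fun t ht => (hlawb t ht).trans_eq (by ring)
  have hvsc : ContinuousOn (fun s => B (SDAC.lqtLaw Sm B C R X r (vs s))) (Ici 0) := by
    simp only [hlqt]
    exact B.continuous.comp_continuousOn
      ((K.continuous.comp_continuousOn hvs.1).neg.sub continuousOn_const)
  have hsdacc : ∀ w : ℝ → Z, ContinuousOn w (Ici 0) →
      ContinuousOn (fun s => SDAC.sdacLaw Sm B C R X r (vp s) (w s)) (Ici 0) := fun w hw => by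
    simp only [hsdac]
    exact (((K.continuous.comp_continuousOn hw).neg.sub
      (F.continuous.comp_continuousOn hvp.1)).sub continuousOn_const)
  have hcont : ∀ (G : Z →L[ℝ] EuclideanSpace ℝ (Fin nu)) (w : ℝ → Z), ContinuousOn w (Ici 0) →
      ContinuousOn (fun t => -K (w t - vs t) + G (vp t)) (Ici 0) := fun G w hw =>
    (K.continuous.comp_continuousOn (hw.sub hvs.1)).neg.add (G.continuous.comp_continuousOn hvp.1)
  refine ⟨fun vh₀ vh hvh => ?_, fun v₀ v hv => ?_⟩
  · have hd : ∀ t, SDAC.sdacLaw Sm B C R X r (vp t) (vh t) - SDAC.lqtLaw Sm B C R X r (vs t)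
        = -K (vh t - vs t) + (-F) (vp t) := fun t => by
      simp only [hsdac, hlqt, map_sub, neg_apply]
      abel
    have hbd : ∀ t, 0 ≤ t → ‖-K (vh t - vs t) + (-F) (vp t)‖
        ≤ (2 * N₁ + N₂ + ‖L‖ * M) * Real.exp (-(β / 2) * t)
          * (‖vp₀‖ + ‖vp₀ + vh₀ - vs₀‖) := fun t ht => by
      have h := hdiff₁ (fun t => vh t - vs t) vp (vh₀ - vs₀) vp₀ (hvh.1.sub hvs.1) hvp'
        (fun t ht => by
          rw [hvh.sub_eq hA.1 hvs (B.continuous.comp_continuousOn (hsdacc vh hvh.1)) hvsc ht]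
          simp only [← map_sub, hd]) t ht
      -- The error starts at `vh₀ - vs₀`, whereas the bound is in terms of `vp₀ + vh₀ - vs₀`; the
      -- triangle inequality costs a second `‖vp₀‖`, hence the factor `2`.
      have h1 : ‖vh₀ - vs₀‖ ≤ ‖vp₀ + vh₀ - vs₀‖ + ‖vp₀‖ := by
        have h2 := norm_sub_le (vp₀ + vh₀ - vs₀) vp₀
        rwa [show vp₀ + vh₀ - vs₀ - vp₀ = vh₀ - vs₀ by abel] at h2
      calc _ ≤ _ := h
        _ ≤ N₁ * Real.exp (-(β / 2) * t) * (2 * (‖vp₀‖ + ‖vp₀ + vh₀ - vs₀‖)) := by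
          gcongr
          linarith [norm_nonneg (vp₀ + vh₀ - vs₀)]
        _ = (2 * N₁) * Real.exp (-(β / 2) * t) * (‖vp₀‖ + ‖vp₀ + vh₀ - vs₀‖) := by ring
        _ ≤ _ := by
          gcongr
          have : 0 ≤ ‖L‖ * M := by positivity
          linarith
    simp only [hd]
    refine ⟨hbd, SDAC.memLp_top_of_exp_decay (hcont (-F) vh hvh.1) hβ2
      (c := (2 * N₁ + N₂ + ‖L‖ * M) * (‖vp₀‖ + ‖vp₀ + vh₀ - vs₀‖)) (by positivity)
      fun t ht => (hbd t ht).trans_eq (by ring)⟩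
  · have hd : ∀ t, SDAC.sdacLaw Sm B C R X r (vp t) (v t - vp t)
        - SDAC.lqtLaw Sm B C R X r (vs t) = -K (v t - vs t) + L (vp t) := fun t => by
      simp only [hsdac, hlqt, hL, map_sub, sub_apply]
      abel
    have hbd : ∀ t, 0 ≤ t → ‖-K (v t - vs t) + L (vp t)‖
        ≤ (2 * N₁ + N₂ + ‖L‖ * M) * Real.exp (-(β / 2) * t)
          * (‖vp₀‖ + ‖v₀ - vs₀‖) := fun t ht => by
      have h := hdiff₂ (fun t => v t - vs t) vp (v₀ - vs₀) vp₀ (hv.1.sub hvs.1) hvp'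
        (fun t ht => by
          rw [hv.sub_eq hA.1 hvs
            (B.continuous.comp_continuousOn (hsdacc _ (hv.1.sub hvp.1))) hvsc ht]
          simp only [← map_sub, hd]) t ht
      refine h.trans ?_
      gcongr
      have : 0 ≤ ‖L‖ * M := by positivity
      linarith
    simp only [hd]
    refine ⟨hbd, SDAC.memLp_top_of_exp_decay (hcont L v hv.1) hβ2
      (c := (2 * N₁ + N₂ + ‖L‖ * M) * (‖vp₀‖ + ‖v₀ - vs₀‖)) (by positivity)
      fun t ht => (hbd t ht).trans_eq (by ring)⟩
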